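/- Let $L^2=L^2(0,2\pi)$ (real-valued functions) and $p\in\{1,2,3\}$. For $n\ge 1$ let $P_n$ be the orthogonal projection of $L^2$ onto $$X_n=\operatorname{span}\Big\{\tfrac1{\sqrt{2\pi}},\tfrac{\cos t}{\sqrt\pi},\tfrac{\sin t}{\sqrt\pi},\dots,\tfrac{\cos nt}{\sqrt\pi},\tfrac{\sin nt}{\sqrt\pi}\Big\}.$$ Let $(A^{(p)}\varphi)(x)=\frac1{(p-1)!}\int_0^x(x-t)^{p-1}\varphi(t)\,dt$ on $L^2$, let $A^{(p)}_n=P_nA^{(p)}P_n:X_n\to X_n$, and let $A_n^{(p)\dagger}$ be the Moore–Penrose inverse of $A_n^{(p)}$ (so $A_n^{(p)\dagger}z$ is the element of smallest norm among the minimisers over $x\in X_n$ of $\|A_n^{(p)}x-z\|$). Let $H^p(0,2\pi)$ be the space of $y\in L^2$ whose weak derivatives of orders $1,\dots,p$ exist and lie in $L^2$; such a $y$ is identified with its representative in $C^{p-1}[0,2\pi]$ whose $(p-1)$-st derivative is the sum of a constant and the primitive of an $L^2$ function, and $y^{(k)}(0)$, $0\le k<p$, are the one-sided derivatives at $0$ of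 this representative; $y^{(p)}\in L^2$ is the weak derivative of order $p$. For $l>0$ let $H^l_{per}(0,2\pi)$ be the space of $\varphi\in L^2$ with $$\|\varphi\|_{H^l_{per}}^2=\xi_0^2+\sum_{k=1}^\infty(1+k^2)^l(\xi_k^2+\eta_k^2)<\infty,$$ where $\xi_0=\frac1{\sqrt{2\pi}}\int_0^{2\pi}\varphi(t)\,dt$, $\xi_k=\frac1{\sqrt\pi}\int_0^{2\pi}\varphi(t)\cos kt\,dt$, $\eta_k=\frac1{\sqrt\pi}\int_0^{2\pi}\varphi(t)\sin kt\,dt$. Put $C^{(1)}=\sqrt3$, $C^{(2)}=11.8040$, $C^{(3)}=345.0754$, and $\gamma^{(p)}=1+\kappa^{(p)}$ with $$\big(\kappa^{(1)}\big)^2=\Big(\tfrac{\sqrt2}{\pi}\Big)^2+\Big(\tfrac2\pi\Big)^2,\qquad \big(\kappa^{(2)}\big)^2=\big(\sqrt2\big)^2+2^2+\pi^2+\Big(\tfrac{3\sqrt2}2\Big)^2+3^2+5^2,$$ $$\big(\kappa^{(3)}\big)^2=\big(11\sqrt2\big)^2+23^2+(11\pi)^2+\Big(\tfrac{44\sqrt2}3\Big)^2+30^2+48^2,\qquad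 \kappa^{(p)}\ge 0.$$ **Theorem 7.1.** Let $p\in\{1,2,3\}$, $n\ge1$, $y\in H^p(0,2\pi)$, and let $y^\delta\in L^2$ satisfy $\|y^\delta-y\|_{L^2}\le\delta$. Then $$\Big\|A_n^{(p)\dagger}P_n\Big(y^\delta-\sum_{k=0}^{p-1}\frac{y^{(k)}(0)}{k!}x^k\Big)-y^{(p)}\Big\|_{L^2}\le C^{(p)}n^p\delta+(\gamma^{(p)}+1)\,\|(I-P_n)y^{(p)}\|_{L^2}.$$ Furthermore, for every real $l>0$ such that $y^{(p)}\in H^l_{per}(0,2\pi)$, $$\Big\|A_n^{(p)\dagger}P_n\Big(y^\delta-\sum_{k=0}^{p-1}\frac{y^{(k)}(0)}{k!}x^k\Big)-y^{(p)}\Big\|_{L^2}\le C^{(p)}n^p\delta+(\gamma^{(p)}+1)\,\frac1{n^l}\,\|y^{(p)}\|_{H^l_{per}}.$$ -/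

import Mathlib

open MeasureTheory Set
open scoped ContDiff

namespace TrigGalerkin

noncomputable section

/-! ## The Hilbert space `L²(0, 2π)` -/

/-- Lebesgue measure on the interval `(0, 2π)`. -/
abbrev mu : Measure ℝ := volume.restrict (Ioo 0 (2 * Real.pi))

/-- The real Hilbert space `L²(0, 2π)`. -/
abbrev L2 : Type := Lp ℝ 2 mu

theorem memLp_of_continuous {f : ℝ → ℝ} (hf : Continuous f) : MemLp f 2 mu := by
  obtain ⟨C, hC⟩ := (isCompact_Icc (a := (0 : ℝ)) (b := 2 * Real.pi)).exists_bound_of_continuousOn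
    hf.continuousOn
  refine MemLp.of_bound hf.aestronglyMeasurable C ?_
  filter_upwards [ae_restrict_mem measurableSet_Ioo] with x hx
  exact hC x (Ioo_subset_Icc_self hx)

/-- The class in `L²(0, 2π)` of a continuous function. -/
def ofContinuous (f : ℝ → ℝ) (hf : Continuous f) : L2 := (memLp_of_continuous hf).toLp f

/-! ## Trigonometric polynomials and the orthogonal projections `P_n` -/

/-- The normalised constant `1 / √(2π)`. -/
def constVec : L2 := ofContinuous (fun _ => 1 / √(2 * Real.pi)) (by fun_prop)

/-- `cos (k t) / √π`. -/
def cosVec (k : ℕ) : L2 := ofContinuous (fun t => Real.cos (k * t) / √Real.pi) (by fun_prop)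

/-- `sin (k t) / √π`. -/
def sinVec (k : ℕ) : L2 := ofContinuous (fun t => Real.sin (k * t) / √Real.pi) (by fun_prop)

/-- `X_n = span {1/√(2π), cos t/√π, sin t/√π, …, cos nt/√π, sin nt/√π}`. -/
def X (n : ℕ) : Submodule ℝ L2 :=
  Submodule.span ℝ ({constVec} ∪ cosVec '' Icc 1 n ∪ sinVec '' Icc 1 n)

instance X_finiteDimensional (n : ℕ) : FiniteDimensional ℝ (X n) :=
  FiniteDimensional.span_of_finite ℝ
    (((finite_singleton _).union ((finite_Icc 1 n).image _)).union ((finite_Icc 1 n).image _))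

/-- The orthogonal projection `P_n` of `L²(0, 2π)` onto `X_n`. -/
def P (n : ℕ) : L2 →L[ℝ] X n := (X n).orthogonalProjectionOnto

/-! ## The integration operator `A⁽ᵖ⁾` -/

/-- `x ↦ 1/(p-1)! ∫₀ˣ (x - t)^(p-1) φ(t) dt` (for `p ≥ 1`). -/
def volterraFun (p : ℕ) (φ : ℝ → ℝ) (x : ℝ) : ℝ :=
  1 / ((p - 1).factorial : ℝ) * ∫ t in Ioo 0 x, (x - t) ^ (p - 1) * φ t

theorem integrable_L2 (φ : L2) : Integrable φ mu :=
  (Lp.memLp φ).integrable (by norm_num)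

theorem integrableOn_kernel (p : ℕ) {φ : ℝ → ℝ} (hφ : Integrable φ mu) {x : ℝ}
    (hx : x ∈ Ioo 0 (2 * Real.pi)) :
    IntegrableOn (fun t => (x - t) ^ (p - 1) * φ t) (Ioo 0 x) := by
  have h1 : IntegrableOn φ (Ioo 0 x) :=
    IntegrableOn.mono_set (t := Ioo 0 (2 * Real.pi)) hφ (Ioo_subset_Ioo_right hx.2.le)
  refine Integrable.bdd_mul (c := (2 * Real.pi) ^ (p - 1)) h1
    (by fun_prop : Continuous fun t : ℝ => (x - t) ^ (p - 1)).aestronglyMeasurable ?_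
  filter_upwards [ae_restrict_mem measurableSet_Ioo] with t ht
  rw [norm_pow, Real.norm_eq_abs, abs_of_pos (by linarith [ht.2])]
  exact pow_le_pow_left₀ (by linarith [ht.2]) (by linarith [ht.1, hx.2]) _

theorem volterraFun_memLp (p : ℕ) (φ : L2) : MemLp (volterraFun p φ) 2 mu := by
  have hm : StronglyMeasurable (volterraFun p φ) := by
    have hφ : StronglyMeasurable (φ : ℝ → ℝ) := Lp.stronglyMeasurable φ
    have h2 : StronglyMeasurable
        (fun z : ℝ × ℝ => ({z : ℝ × ℝ | 0 < z.2 ∧ z.2 < z.1}).indicator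
          (fun z => (z.1 - z.2) ^ (p - 1) * φ z.2) z) := by
      refine StronglyMeasurable.indicator ?_ ?_
      · exact ((by fun_prop : Continuous fun z : ℝ × ℝ => (z.1 - z.2) ^ (p - 1)).stronglyMeasurable).mul
          (hφ.comp_measurable measurable_snd)
      · exact (measurableSet_lt measurable_const measurable_snd).inter
          (measurableSet_lt measurable_snd measurable_fst)
    have h3 := (h2.integral_prod_right' (ν := (volume : Measure ℝ))).const_mul (1 / ((p - 1).factorial : ℝ))
    convert h3 using 2 with x
    unfold volterraFun
    rw [← integral_indicator measurableSet_Ioo]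
    rfl
  refine MemLp.of_bound hm.aestronglyMeasurable
    (1 / ((p - 1).factorial : ℝ) * ((2 * Real.pi) ^ (p - 1) * ∫ t, ‖φ t‖ ∂mu)) ?_
  filter_upwards [ae_restrict_mem measurableSet_Ioo] with x hx
  have hφ := integrable_L2 φ
  have hx2 : IntegrableOn (fun t => ‖φ t‖) (Ioo 0 (2 * Real.pi)) := hφ.norm
  unfold volterraFun
  rw [norm_mul, Real.norm_of_nonneg (by positivity)]
  refine mul_le_mul_of_nonneg_left ?_ (by positivity)
  rw [← integral_const_mul]
  refine (norm_integral_le_integral_norm _).trans ?_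
  refine le_trans (setIntegral_mono_on (integrableOn_kernel p hφ hx).norm
    ((hx2.mono_set (Ioo_subset_Ioo_right hx.2.le)).const_mul ((2 * Real.pi) ^ (p - 1)))
    measurableSet_Ioo ?_) ?_
  · intro t ht
    rw [norm_mul, norm_pow, Real.norm_eq_abs (x - t), abs_of_pos (by linarith [ht.2])]
    exact mul_le_mul_of_nonneg_right
      (pow_le_pow_left₀ (by linarith [ht.2]) (by linarith [ht.1, hx.2]) _) (norm_nonneg _)
  · refine setIntegral_mono_set (hx2.const_mul _) ?_ (Ioo_subset_Ioo_right hx.2.le).eventuallyLE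
    exact Filter.Eventually.of_forall fun t => by
      have := Real.pi_pos
      positivity

theorem volterraFun_congr (p : ℕ) {φ ψ : ℝ → ℝ} (h : φ =ᵐ[mu] ψ) {x : ℝ}
    (hx : x ∈ Ioo 0 (2 * Real.pi)) : volterraFun p φ x = volterraFun p ψ x := by
  unfold volterraFun
  congr 1
  refine integral_congr_ae ?_
  have hs : Ioo 0 x ⊆ Ioo 0 (2 * Real.pi) := Ioo_subset_Ioo_right hx.2.le
  filter_upwards [ae_restrict_of_ae_restrict_of_subset hs h] with t ht
  rw [ht]

/-- The integro-differential operator `A⁽ᵖ⁾ : L²(0, 2π) → L²(0, 2π)`, `p ≥ 1`. -/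
def A (p : ℕ) : L2 →ₗ[ℝ] L2 where
  toFun φ := (volterraFun_memLp p φ).toLp _
  map_add' φ ψ := by
    rw [← MemLp.toLp_add]
    refine MemLp.toLp_congr _ _ ?_
    filter_upwards [ae_restrict_mem measurableSet_Ioo] with x hx
    rw [volterraFun_congr p (Lp.coeFn_add φ ψ) hx]
    simp only [volterraFun, Pi.add_apply, mul_add]
    rw [integral_add (integrableOn_kernel p (integrable_L2 φ) hx)
      (integrableOn_kernel p (integrable_L2 ψ) hx), mul_add]
  map_smul' c φ := by
    rw [RingHom.id_apply, ← MemLp.toLp_const_smul]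
    refine MemLp.toLp_congr _ _ ?_
    filter_upwards [ae_restrict_mem measurableSet_Ioo] with x hx
    rw [volterraFun_congr p (Lp.coeFn_smul c φ) hx]
    simp only [volterraFun, Pi.smul_apply, smul_eq_mul, mul_left_comm _ c]
    rw [integral_const_mul]
    ring

/-- The Galerkin operator `A_n⁽ᵖ⁾ = P_n A⁽ᵖ⁾ P_n : X_n → X_n` (on `X_n` the inner `P_n` is the
inclusion). -/
def galerkin (p n : ℕ) : X n →ₗ[ℝ] X n :=
  (P n : L2 →ₗ[ℝ] X n) ∘ₗ A p ∘ₗ (X n).subtype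

/-! ## The Moore–Penrose inverse -/

section MoorePenrose

variable {E F : Type*} [NormedAddCommGroup E] [InnerProductSpace ℝ E]
  [NormedAddCommGroup F] [InnerProductSpace ℝ F]

/-- `x` minimises `‖T x - y‖`. -/
def IsLeastSquares (T : E →ₗ[ℝ] F) (y : F) (x : E) : Prop := ∀ z, ‖T x - y‖ ≤ ‖T z - y‖

/-- `x` is the element of smallest norm among the minimisers of `‖T x - y‖`. -/
def IsMinNormLeastSquares (T : E →ₗ[ℝ] F) (y : F) (x : E) : Prop :=
  IsLeastSquares T y x ∧ ∀ z, IsLeastSquares T y z → z ≠ x → ‖x‖ < ‖z‖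

theorem exists_isMinNormLeastSquares [FiniteDimensional ℝ E] (T : E →ₗ[ℝ] F) (y : F) :
    ∃ x, IsMinNormLeastSquares T y x := by
  let R := LinearMap.range T
  obtain ⟨x₀, hx₀⟩ : (R.orthogonalProjectionOnto y : F) ∈ R := (R.orthogonalProjectionOnto y).2
  let N := LinearMap.ker T
  let x : E := x₀ - N.orthogonalProjectionOnto x₀
  have hTx : T x = R.orthogonalProjectionOnto y := by
    have : T (N.orthogonalProjectionOnto x₀ : E) = 0 := (N.orthogonalProjectionOnto x₀).2
    rw [← hx₀, map_sub, this, sub_zero]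
  have hpy : ∀ z, ‖T z - y‖ ^ 2 = ‖T z - T x‖ ^ 2 + ‖T x - y‖ ^ 2 := by
    intro z
    have h0 : inner ℝ (T z - T x) (T x - y) = 0 := by
      have h1 : y - R.orthogonalProjectionOnto y ∈ Rᗮ := R.sub_starProjection_mem_orthogonal y
      have h2 := (Submodule.mem_orthogonal R _).1 h1 (T z - T x)
        (R.sub_mem ⟨z, rfl⟩ ⟨x, rfl⟩)
      rw [← hTx] at h2
      rw [← neg_sub y, inner_neg_right, h2, neg_zero]
    have := norm_add_sq_eq_norm_sq_add_norm_sq_of_inner_eq_zero _ _ h0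
    rw [sub_add_sub_cancel] at this
    nlinarith
  have hle : IsLeastSquares T y x := fun z => by
    refine le_of_sq_le_sq ?_ (norm_nonneg _)
    rw [hpy z]; nlinarith [sq_nonneg ‖T z - T x‖]
  refine ⟨x, hle, fun z hz hne => ?_⟩
  have hTz : T z = T x := by
    have h1 := hz x
    have h2 := hpy z
    have h3 : ‖T z - T x‖ ^ 2 ≤ 0 := by nlinarith [norm_nonneg (T z - y), norm_nonneg (T x - y)]
    have h4 : ‖T z - T x‖ = 0 := by nlinarith [norm_nonneg (T z - T x)]
    exact sub_eq_zero.1 (norm_eq_zero.1 h4)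
  have hmem : z - x ∈ N := by simp [N, hTz]
  have hx : x ∈ Nᗮ := N.sub_starProjection_mem_orthogonal x₀
  have h0 : inner ℝ (z - x) x = 0 := (Submodule.mem_orthogonal N _).1 hx _ hmem
  have h1 := norm_add_sq_eq_norm_sq_add_norm_sq_of_inner_eq_zero _ _ h0
  rw [sub_add_cancel] at h1
  have h2 : 0 < ‖z - x‖ := norm_pos_iff.2 (sub_ne_zero.2 hne)
  nlinarith [norm_nonneg x, norm_nonneg z]

/-- The Moore–Penrose inverse `T† y`: the least-squares solution of `T x = y` of smallest norm. -/
def moorePenrose [FiniteDimensional ℝ E] (T : E →ₗ[ℝ] F) (y : F) : E :=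
  (exists_isMinNormLeastSquares T y).choose

end MoorePenrose

/-! ## Sobolev spaces `Hᵖ(0, 2π)` -/

/-- `ζ ∈ L²(0, 2π)` is the `k`-th weak derivative of `y ∈ L²(0, 2π)`: the identity is tested
against all functions of class `C^∞` with compact support inside `(0, 2π)`. -/
def IsWeakDeriv (k : ℕ) (y ζ : L2) : Prop :=
  ∀ φ : ℝ → ℝ, ContDiff ℝ ∞ φ → HasCompactSupport φ → tsupport φ ⊆ Ioo 0 (2 * Real.pi) →
    ∫ x, ζ x * φ x ∂mu = (-1) ^ k * ∫ x, y x * iteratedDeriv k φ x ∂mu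

/-- The Sobolev space `Hᵖ(0, 2π)`: the weak derivatives `D¹y, …, Dᵖy` exist in `L²(0, 2π)`. -/
def sobolev (p : ℕ) : Set L2 := {y | ∀ k, 1 ≤ k → k ≤ p → ∃ ζ : L2, IsWeakDeriv k y ζ}

open Classical in
/-- The weak derivative `Dᵏy ∈ L²(0, 2π)` (equal to `0` if there is none). -/
def weakDeriv (k : ℕ) (y : L2) : L2 :=
  if h : ∃ ζ : L2, IsWeakDeriv k y ζ then h.choose else 0

/-- `f` is a representative of `y` which is of class `C^(p-1)` on `[0, 2π]` and whose `(p-1)`-st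
derivative is `α + ∫₀ˣ Ψ(t) dt` with `Ψ ∈ L²(0, 2π)`; derivatives at the end points are
one-sided. -/
def IsFineRep (p : ℕ) (y : L2) (f : ℝ → ℝ) : Prop :=
  y =ᵐ[mu] f ∧ ContDiffOn ℝ ((p - 1 : ℕ) : WithTop ℕ∞) f (Icc 0 (2 * Real.pi)) ∧
    ∃ (α : ℝ) (Ψ : L2), ∀ x ∈ Icc 0 (2 * Real.pi),
      iteratedDerivWithin (p - 1) f (Icc 0 (2 * Real.pi)) x = α + ∫ t in Ioo 0 x, Ψ t

open Classical in
/-- The fine representative of `y ∈ Hᵖ(0, 2π)`, `p ≥ 1`; its values on `[0, 2π]` are determined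
by `y`. -/
def fineRep (p : ℕ) (y : L2) : ℝ → ℝ :=
  if h : ∃ f : ℝ → ℝ, IsFineRep p y f then h.choose else 0

/-- The initial value `y⁽ᵏ⁾(0)` (for `k < p`) of `y ∈ Hᵖ(0, 2π)`. -/
def initialValue (p : ℕ) (y : L2) (k : ℕ) : ℝ :=
  iteratedDerivWithin k (fineRep p y) (Icc 0 (2 * Real.pi)) 0

/-- The Taylor polynomial `∑_{k=0}^{p-1} y⁽ᵏ⁾(0)/k! xᵏ`, as an element of `L²(0, 2π)`. -/
def taylor (p : ℕ) (y : L2) : L2 :=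
  ofContinuous (fun x => ∑ k ∈ Finset.range p, initialValue p y k / (k.factorial : ℝ) * x ^ k)
    (by fun_prop)

/-! ## Periodic Sobolev spaces of real order -/

/-- `ξ₀ = 1/√(2π) ∫₀^{2π} φ(t) dt`. -/
def coeffConst (φ : L2) : ℝ := 1 / √(2 * Real.pi) * ∫ t, φ t ∂mu

/-- `ξ_k = 1/√π ∫₀^{2π} φ(t) cos kt dt`. -/
def coeffCos (φ : L2) (k : ℕ) : ℝ := 1 / √Real.pi * ∫ t, φ t * Real.cos (k * t) ∂mu

/-- `η_k = 1/√π ∫₀^{2π} φ(t) sin kt dt`. -/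
def coeffSin (φ : L2) (k : ℕ) : ℝ := 1 / √Real.pi * ∫ t, φ t * Real.sin (k * t) ∂mu

/-- The term with index `k + 1` of `∑_{k ≥ 1} (1 + k²)^s (ξ_k² + η_k²)`. -/
def perTerm (s : ℝ) (φ : L2) (k : ℕ) : ℝ :=
  (1 + ((k + 1 : ℕ) : ℝ) ^ 2) ^ s * (coeffCos φ (k + 1) ^ 2 + coeffSin φ (k + 1) ^ 2)

/-- The periodic Sobolev space `H^s_per(0, 2π)`. -/
def perSobolev (s : ℝ) : Set L2 := {φ | Summable (perTerm s φ)}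

/-- The norm of `H^s_per(0, 2π)`. -/
def perNorm (s : ℝ) (φ : L2) : ℝ := √(coeffConst φ ^ 2 + ∑' k, perTerm s φ k)

/-! ## The constants -/

/-- The constants `C⁽ᵖ⁾` of the noise error, `p = 1, 2, 3`. -/
def noiseConst : ℕ → ℝ
  | 1 => √3
  | 2 => 11.8040
  | 3 => 345.0754
  | _ => 0

/-- The sum `∑_{i=1}^6 (C_i⁽ᵖ⁾)²` of the squares of the decay constants, `p = 1, 2, 3`. -/
def decaySq : ℕ → ℝ
  | 1 => 0 ^ 2 + 0 ^ 2 + 0 ^ 2 + (√2 / Real.pi) ^ 2 + (2 / Real.pi) ^ 2 + 0 ^ 2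
  | 2 => √2 ^ 2 + 2 ^ 2 + Real.pi ^ 2 + (3 * √2 / 2) ^ 2 + 3 ^ 2 + 5 ^ 2
  | 3 => (11 * √2) ^ 2 + 23 ^ 2 + (11 * Real.pi) ^ 2 + (44 * √2 / 3) ^ 2 + 30 ^ 2 + 48 ^ 2
  | _ => 0

/-- `γ⁽ᵖ⁾ = 1 + κ⁽ᵖ⁾` with `κ⁽ᵖ⁾ = √(∑ (C_i⁽ᵖ⁾)²)`. -/
def gammaConst (p : ℕ) : ℝ := 1 + √(decaySq p)

end

end TrigGalerkin

namespace TrigGalerkin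

/-! Subtracting the Taylor polynomial leaves exact data `A p ζ` with `ζ = y^(p)` (`sub_taylor_eq`).
The Galerkin operator turns out to be bijective on `X n`, so its Moore–Penrose inverse is its
inverse. Writing `ζ = P n ζ + r` with `r ⟂ X n`, the error is the sum of the Galerkin solution for
the noise, the Galerkin solution for the data `A p r`, and `-r`. Two bounds suffice: `C n^p` for the
inverse (`exists_galerkin_eq`) and `γ ‖r‖` for the second solution
(`exists_galerkin_eq_of_orthogonal`).

Both come from one explicit construction, `exists_approx_solution`. To solve the Galerkin equation
with smooth right-hand side `g`, look for `h ⟂ X n` such that `g + h` vanishes to order `p` at `0`;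
then `A p` maps the `p`-th derivative of `g + h` back to `g + h`. Take `h` to be a combination of
`p` Fourier remainders of polynomials. Their `p`-th derivatives are derivatives of the Dirichlet
kernel, hence lie in `X n`. The `p` conditions at `0` form a linear system which, rescaled by powers
of `N = n + 1/2`, depends only on `ν = N ∑_{k>n} 1/k²`. Since `0 ≤ ν ≤ 1`, its determinant stays
away from zero.

For the inverse, `g` is a trigonometric polynomial, whose derivatives are controlled by Bernstein's
inequality and by the norm of evaluation at `0`. For `p = 1` this is not sharp enough, and the same
explicit solution is estimated by separating cosine and sine coefficients. For `A p r`, repeatedly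
splitting off mean values shows that, modulo the complement of `X n`, `A p r` is a polynomial of
degree less than `p`; its coefficients are small enough to cancel every power of `N`.

The rate in the periodic Sobolev scale is Parseval's identity applied to `ζ - P n ζ`. -/

/-! ### Inner products of continuous functions in `L²(0, 2π)`. -/

theorem two_pi_nonneg : (0 : ℝ) ≤ 2 * Real.pi := Real.two_pi_pos.le

theorem integral_mu (f : ℝ → ℝ) : ∫ x, f x ∂mu = ∫ x in (0 : ℝ)..2 * Real.pi, f x := by
  rw [intervalIntegral.integral_of_le two_pi_nonneg, integral_Ioc_eq_integral_Ioo]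

theorem inner_eq_integral (φ ψ : L2) : inner ℝ φ ψ = ∫ x, φ x * ψ x ∂mu := by
  rw [L2.inner_def]
  refine integral_congr_ae (Filter.Eventually.of_forall fun x => ?_)
  simp [mul_comm]

/-- The class in `L²(0, 2π)` of a continuous function, as a linear map. -/
noncomputable def toL2 : C(ℝ, ℝ) →ₗ[ℝ] L2 where
  toFun f := ofContinuous f f.continuous
  map_add' _ _ := rfl
  map_smul' _ _ := rfl

theorem toL2_ae (f : C(ℝ, ℝ)) : toL2 f =ᵐ[mu] f :=
  MemLp.coeFn_toLp (memLp_of_continuous f.continuous)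

theorem inner_toL2_right (φ : L2) (f : C(ℝ, ℝ)) :
    inner ℝ φ (toL2 f) = ∫ x, φ x * f x ∂mu := by
  rw [inner_eq_integral]
  refine integral_congr_ae ?_
  filter_upwards [toL2_ae f] with x hx
  rw [hx]

theorem inner_toL2 (f g : C(ℝ, ℝ)) :
    inner ℝ (toL2 f) (toL2 g) = ∫ x in (0 : ℝ)..2 * Real.pi, f x * g x := by
  rw [inner_toL2_right, ← integral_mu]
  refine integral_congr_ae ?_
  filter_upwards [toL2_ae f] with x hx
  rw [hx]

theorem toL2_eq_of_eqOn {f g : C(ℝ, ℝ)} (h : EqOn f g (Ioo 0 (2 * Real.pi))) :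
    toL2 f = toL2 g := by
  refine Lp.ext ?_
  filter_upwards [toL2_ae f, toL2_ae g, ae_restrict_mem measurableSet_Ioo] with x hf hg hx
  rw [hf, hg, h hx]

/-! ## Trigonometric polynomials -/

/-- The trigonometric polynomial with coefficients `c₀`, `c`, `s`. -/
noncomputable def trig (n : ℕ) (c₀ : ℝ) (c s : ℕ → ℝ) : C(ℝ, ℝ) :=
  ⟨fun x => c₀ + ∑ k ∈ Finset.Icc 1 n, (c k * Real.cos (k * x) + s k * Real.sin (k * x)),
    by fun_prop⟩

theorem trig_apply (n : ℕ) (c₀ : ℝ) (c s : ℕ → ℝ) (x : ℝ) : trig n c₀ c s x =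
    c₀ + ∑ k ∈ Finset.Icc 1 n, (c k * Real.cos (k * x) + s k * Real.sin (k * x)) := rfl

theorem trig_add (n : ℕ) (c₀ d₀ : ℝ) (c s d t : ℕ → ℝ) :
    trig n c₀ c s + trig n d₀ d t = trig n (c₀ + d₀) (c + d) (s + t) := by
  ext x
  simp only [ContinuousMap.add_apply, trig_apply, Pi.add_apply, add_mul, Finset.sum_add_distrib]
  ring

theorem smul_trig (n : ℕ) (a c₀ : ℝ) (c s : ℕ → ℝ) :
    a • trig n c₀ c s = trig n (a * c₀) (a • c) (a • s) := by
  ext x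
  simp only [ContinuousMap.smul_apply, trig_apply, Pi.smul_apply, smul_eq_mul, mul_add,
    Finset.mul_sum, mul_assoc]

theorem hasDerivAt_trig (n : ℕ) (c₀ : ℝ) (c s : ℕ → ℝ) (x : ℝ) :
    HasDerivAt (trig n c₀ c s) (trig n 0 (fun k => k * s k) (fun k => -(k * c k)) x) x := by
  have h : ∀ k ∈ Finset.Icc 1 n, HasDerivAt
      (fun x : ℝ => c k * Real.cos (k * x) + s k * Real.sin (k * x))
      (k * s k * Real.cos (k * x) + -(k * c k) * Real.sin (k * x)) x := by
    intro k _
    have h0 : HasDerivAt (fun x : ℝ => (k : ℝ) * x) k x := by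
      simpa using (hasDerivAt_id x).const_mul (k : ℝ)
    refine ((h0.cos.const_mul (c k)).add (h0.sin.const_mul (s k))).congr_deriv ?_
    ring
  rw [trig_apply, zero_add]
  exact (HasDerivAt.fun_sum h).const_add c₀

theorem trig_zero (n : ℕ) (c₀ : ℝ) (c s : ℕ → ℝ) :
    trig n c₀ c s 0 = c₀ + ∑ k ∈ Finset.Icc 1 n, c k := by
  simp [trig_apply]

theorem trig_two_pi (n : ℕ) (c₀ : ℝ) (c s : ℕ → ℝ) :
    trig n c₀ c s (2 * Real.pi) = trig n c₀ c s 0 := by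
  simp [trig_apply, Real.cos_nat_mul_two_pi,
    fun k : ℕ => (show Real.sin (k * (2 * Real.pi)) = 0 by
      simpa using Real.sin_add_nat_mul_two_pi 0 k)]

theorem trig_const (n : ℕ) (c₀ x : ℝ) : trig n c₀ 0 0 x = c₀ := by simp [trig_apply]

theorem trig_single_cos {n k : ℕ} (hk : k ∈ Finset.Icc 1 n) (x : ℝ) :
    trig n 0 (Pi.single k 1) 0 x = Real.cos (k * x) := by
  rw [trig_apply, zero_add, Finset.sum_eq_single k]
  · simp
  · intro j _ hj; simp [hj]
  · exact fun h => absurd hk h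

theorem trig_single_sin {n k : ℕ} (hk : k ∈ Finset.Icc 1 n) (x : ℝ) :
    trig n 0 0 (Pi.single k 1) x = Real.sin (k * x) := by
  rw [trig_apply, zero_add, Finset.sum_eq_single k]
  · simp
  · intro j _ hj; simp [hj]
  · exact fun h => absurd hk h

theorem cosVec_eq (k : ℕ) :
    cosVec k = (1 / √Real.pi) • toL2 ⟨fun x => Real.cos (k * x), by fun_prop⟩ := by
  rw [← map_smul]
  refine toL2_eq_of_eqOn (f := ⟨fun t => Real.cos (k * t) / √Real.pi, by fun_prop⟩) fun x _ => ?_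
  simp [div_eq_inv_mul]

theorem sinVec_eq (k : ℕ) :
    sinVec k = (1 / √Real.pi) • toL2 ⟨fun x => Real.sin (k * x), by fun_prop⟩ := by
  rw [← map_smul]
  refine toL2_eq_of_eqOn (f := ⟨fun t => Real.sin (k * t) / √Real.pi, by fun_prop⟩) fun x _ => ?_
  simp [div_eq_inv_mul]

theorem constVec_eq : constVec = (1 / √(2 * Real.pi)) • toL2 1 := by
  rw [← map_smul]
  refine toL2_eq_of_eqOn (f := ⟨fun t => 1 / √(2 * Real.pi), by fun_prop⟩) fun x _ => ?_
  simp

theorem toL2_one_mem_X (n : ℕ) : toL2 1 ∈ X n := by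
  have h : constVec ∈ X n := Submodule.subset_span (by simp)
  rw [constVec_eq] at h
  refine (Submodule.smul_mem_iff _ ?_).1 h
  have := Real.pi_pos
  positivity

theorem toL2_cos_mem_X {n k : ℕ} (hk : k ∈ Finset.Icc 1 n) :
    toL2 ⟨fun x => Real.cos (k * x), by fun_prop⟩ ∈ X n := by
  have h : cosVec k ∈ X n :=
    Submodule.subset_span (Or.inl (Or.inr ⟨k, by simpa using hk, rfl⟩))
  rw [cosVec_eq] at h
  refine (Submodule.smul_mem_iff _ ?_).1 h
  have := Real.pi_pos
  positivity

theorem toL2_sin_mem_X {n k : ℕ} (hk : k ∈ Finset.Icc 1 n) :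
    toL2 ⟨fun x => Real.sin (k * x), by fun_prop⟩ ∈ X n := by
  have h : sinVec k ∈ X n := Submodule.subset_span (Or.inr ⟨k, by simpa using hk, rfl⟩)
  rw [sinVec_eq] at h
  refine (Submodule.smul_mem_iff _ ?_).1 h
  have := Real.pi_pos
  positivity

theorem trig_mem_X (n : ℕ) (c₀ : ℝ) (c s : ℕ → ℝ) : toL2 (trig n c₀ c s) ∈ X n := by
  have : trig n c₀ c s = c₀ • 1 + ∑ k ∈ Finset.Icc 1 n,
      (c k • (⟨fun x => Real.cos (k * x), by fun_prop⟩ : C(ℝ, ℝ))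
        + s k • (⟨fun x => Real.sin (k * x), by fun_prop⟩ : C(ℝ, ℝ))) := by
    ext x; simp [trig_apply, ContinuousMap.sum_apply]
  rw [this, map_add, map_sum, map_smul]
  refine add_mem (Submodule.smul_mem _ _ (toL2_one_mem_X n)) (sum_mem fun k hk => ?_)
  rw [map_add, map_smul, map_smul]
  exact add_mem (Submodule.smul_mem _ _ (toL2_cos_mem_X hk))
    (Submodule.smul_mem _ _ (toL2_sin_mem_X hk))

theorem exists_trig_of_mem_X {n : ℕ} {v : L2} (hv : v ∈ X n) :
    ∃ c₀ c s, v = toL2 (trig n c₀ c s) := by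
  induction hv using Submodule.span_induction with
  | mem v hv =>
    rcases hv with (hv | ⟨k, hk, rfl⟩) | ⟨k, hk, rfl⟩
    · rw [mem_singleton_iff.1 hv, constVec_eq, ← map_smul]
      exact ⟨1 / √(2 * Real.pi), 0, 0, toL2_eq_of_eqOn fun x _ => by rw [trig_const]; simp⟩
    · have h : toL2 ⟨fun x => Real.cos (k * x), by fun_prop⟩ = toL2 (trig n 0 (Pi.single k 1) 0) :=
        toL2_eq_of_eqOn fun x _ => (trig_single_cos (by simpa using hk) x).symm
      rw [cosVec_eq, h, ← map_smul, smul_trig]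
      exact ⟨_, _, _, rfl⟩
    · have h : toL2 ⟨fun x => Real.sin (k * x), by fun_prop⟩ = toL2 (trig n 0 0 (Pi.single k 1)) :=
        toL2_eq_of_eqOn fun x _ => (trig_single_sin (by simpa using hk) x).symm
      rw [sinVec_eq, h, ← map_smul, smul_trig]
      exact ⟨_, _, _, rfl⟩
  | zero => exact ⟨0, 0, 0, by rw [← map_zero toL2]; congr 1; ext x; simp [trig_apply]⟩
  | add v w _ _ hv hw =>
    obtain ⟨c₀, c, s, rfl⟩ := hv
    obtain ⟨d₀, d, t, rfl⟩ := hw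
    exact ⟨_, _, _, by rw [← map_add, trig_add]⟩
  | smul a v _ hv =>
    obtain ⟨c₀, c, s, rfl⟩ := hv
    exact ⟨_, _, _, by rw [← map_smul, smul_trig]⟩

/-! ## Orthogonality relations -/

theorem integral_cos_int_mul {m : ℤ} (hm : m ≠ 0) :
    ∫ x in (0 : ℝ)..2 * Real.pi, Real.cos (m * x) = 0 := by
  have hm' : (m : ℝ) ≠ 0 := by exact_mod_cast hm
  rw [intervalIntegral.integral_comp_mul_left _ hm', integral_cos, mul_zero, Real.sin_zero,
    show Real.sin (m * (2 * Real.pi)) = 0 by simpa using Real.sin_add_int_mul_two_pi 0 m]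
  simp

theorem integral_sin_int_mul (m : ℤ) :
    ∫ x in (0 : ℝ)..2 * Real.pi, Real.sin (m * x) = 0 := by
  rcases eq_or_ne m 0 with rfl | hm
  · simp
  have hm' : (m : ℝ) ≠ 0 := by exact_mod_cast hm
  rw [intervalIntegral.integral_comp_mul_left _ hm']
  simp

theorem integral_cos_mul_cos {j k : ℕ} (hk : 1 ≤ k) :
    ∫ x in (0 : ℝ)..2 * Real.pi, Real.cos (j * x) * Real.cos (k * x)
      = if j = k then Real.pi else 0 := by
  have h : ∀ x : ℝ, Real.cos (j * x) * Real.cos (k * x)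
      = (Real.cos (((j - k : ℤ) : ℝ) * x) + Real.cos (((j + k : ℤ) : ℝ) * x)) * (1 / 2) := by
    intro x
    push_cast
    rw [sub_mul, add_mul (j : ℝ), Real.cos_sub, Real.cos_add]
    ring
  simp_rw [h]
  rw [intervalIntegral.integral_mul_const, intervalIntegral.integral_add
    (Continuous.intervalIntegrable (by fun_prop) _ _)
    (Continuous.intervalIntegrable (by fun_prop) _ _),
    integral_cos_int_mul (m := j + k) (by omega)]
  split_ifs with hjk
  · subst hjk; simp; ring
  · rw [integral_cos_int_mul (by omega)]; simp

theorem integral_sin_mul_sin {j k : ℕ} (hk : 1 ≤ k) :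
    ∫ x in (0 : ℝ)..2 * Real.pi, Real.sin (j * x) * Real.sin (k * x)
      = if j = k then Real.pi else 0 := by
  have h : ∀ x : ℝ, Real.sin (j * x) * Real.sin (k * x)
      = (Real.cos (((j - k : ℤ) : ℝ) * x) - Real.cos (((j + k : ℤ) : ℝ) * x)) * (1 / 2) := by
    intro x
    push_cast
    rw [sub_mul (j : ℝ), add_mul (j : ℝ), Real.cos_sub, Real.cos_add]
    ring
  simp_rw [h]
  rw [intervalIntegral.integral_mul_const, intervalIntegral.integral_sub
    (Continuous.intervalIntegrable (by fun_prop) _ _)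
    (Continuous.intervalIntegrable (by fun_prop) _ _),
    integral_cos_int_mul (m := j + k) (by omega)]
  split_ifs with hjk
  · subst hjk; simp; ring
  · rw [integral_cos_int_mul (by omega)]; simp

theorem integral_sin_mul_cos (j k : ℕ) :
    ∫ x in (0 : ℝ)..2 * Real.pi, Real.sin (j * x) * Real.cos (k * x) = 0 := by
  have h : ∀ x : ℝ, Real.sin (j * x) * Real.cos (k * x)
      = (Real.sin (((j - k : ℤ) : ℝ) * x) + Real.sin (((j + k : ℤ) : ℝ) * x)) * (1 / 2) := by
    intro x
    push_cast
    rw [sub_mul, add_mul (j : ℝ), Real.sin_sub, Real.sin_add]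
    ring
  simp_rw [h]
  rw [intervalIntegral.integral_mul_const, intervalIntegral.integral_add
    (Continuous.intervalIntegrable (by fun_prop) _ _)
    (Continuous.intervalIntegrable (by fun_prop) _ _), integral_sin_int_mul, integral_sin_int_mul]
  simp

/-- Pairing of a continuous function with a trigonometric polynomial. -/
theorem integral_mul_trig (f : C(ℝ, ℝ)) (n : ℕ) (c₀ : ℝ) (c s : ℕ → ℝ) :
    ∫ x in (0 : ℝ)..2 * Real.pi, f x * trig n c₀ c s x
      = c₀ * (∫ x in (0 : ℝ)..2 * Real.pi, f x)
        + ∑ k ∈ Finset.Icc 1 n, (c k * (∫ x in (0 : ℝ)..2 * Real.pi, f x * Real.cos (k * x))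
          + s k * (∫ x in (0 : ℝ)..2 * Real.pi, f x * Real.sin (k * x))) := by
  simp_rw [trig_apply, mul_add, Finset.mul_sum]
  rw [intervalIntegral.integral_add (Continuous.intervalIntegrable (by fun_prop) _ _)
    (Continuous.intervalIntegrable (by fun_prop) _ _), intervalIntegral.integral_mul_const,
    mul_comm, intervalIntegral.integral_finsetSum
      fun k _ => Continuous.intervalIntegrable (by fun_prop) _ _]
  congr 1
  refine Finset.sum_congr rfl fun k _ => ?_
  rw [← intervalIntegral.integral_const_mul, ← intervalIntegral.integral_const_mul,
    ← intervalIntegral.integral_add (Continuous.intervalIntegrable (by fun_prop) _ _)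
    (Continuous.intervalIntegrable (by fun_prop) _ _)]
  congr 1
  ext x
  ring

theorem integral_trig (n : ℕ) (c₀ : ℝ) (c s : ℕ → ℝ) :
    ∫ x in (0 : ℝ)..2 * Real.pi, trig n c₀ c s x = 2 * Real.pi * c₀ := by
  have h := integral_mul_trig 1 n c₀ c s
  simp only [ContinuousMap.one_apply, one_mul] at h
  rw [h, Finset.sum_eq_zero]
  · simp [mul_comm]
  · intro k hk
    have hc := integral_cos_int_mul (m := k) (by have := (Finset.mem_Icc.1 hk).1; omega)
    have hs := integral_sin_int_mul (m := k)
    push_cast at hc hs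
    rw [hc, hs]
    simp

theorem integral_cos_mul_trig {n j : ℕ} (hj : j ∈ Finset.Icc 1 n) (c₀ : ℝ) (c s : ℕ → ℝ) :
    ∫ x in (0 : ℝ)..2 * Real.pi, Real.cos (j * x) * trig n c₀ c s x = Real.pi * c j := by
  have h := integral_mul_trig ⟨fun x => Real.cos (j * x), by fun_prop⟩ n c₀ c s
  simp only [ContinuousMap.coe_mk] at h
  have hc := integral_cos_int_mul (m := j) (by have := (Finset.mem_Icc.1 hj).1; omega)
  push_cast at hc
  rw [h, hc, Finset.sum_eq_single j]
  · have h2 := integral_sin_mul_cos j j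
    simp only [mul_comm (Real.sin _)] at h2
    rw [integral_cos_mul_cos (Finset.mem_Icc.1 hj).1, h2]
    simp [mul_comm]
  · intro k hk hkj
    have h2 := integral_sin_mul_cos k j
    simp only [mul_comm (Real.sin _)] at h2
    rw [integral_cos_mul_cos (Finset.mem_Icc.1 hk).1, h2, if_neg (Ne.symm hkj)]
    simp
  · exact fun h => absurd hj h

theorem integral_sin_mul_trig {n j : ℕ} (hj : j ∈ Finset.Icc 1 n) (c₀ : ℝ) (c s : ℕ → ℝ) :
    ∫ x in (0 : ℝ)..2 * Real.pi, Real.sin (j * x) * trig n c₀ c s x = Real.pi * s j := by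
  have h := integral_mul_trig ⟨fun x => Real.sin (j * x), by fun_prop⟩ n c₀ c s
  simp only [ContinuousMap.coe_mk] at h
  have hc := integral_sin_int_mul (m := j)
  push_cast at hc
  rw [h, hc, Finset.sum_eq_single j]
  · rw [integral_sin_mul_sin (Finset.mem_Icc.1 hj).1, integral_sin_mul_cos]
    simp [mul_comm]
  · intro k hk hkj
    rw [integral_sin_mul_sin (Finset.mem_Icc.1 hk).1, integral_sin_mul_cos, if_neg (Ne.symm hkj)]
    simp
  · exact fun h => absurd hj h

theorem inner_trig (n : ℕ) (c₀ d₀ : ℝ) (c s d t : ℕ → ℝ) :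
    inner ℝ (toL2 (trig n c₀ c s)) (toL2 (trig n d₀ d t))
      = 2 * Real.pi * (c₀ * d₀) + Real.pi * ∑ k ∈ Finset.Icc 1 n, (c k * d k + s k * t k) := by
  rw [inner_toL2, integral_mul_trig, integral_trig, Finset.mul_sum]
  refine congrArg₂ _ (by ring) (Finset.sum_congr rfl fun k hk => ?_)
  simp only [mul_comm (trig n c₀ c s _)]
  rw [integral_cos_mul_trig hk, integral_sin_mul_trig hk]
  ring

theorem norm_sq_trig (n : ℕ) (c₀ : ℝ) (c s : ℕ → ℝ) :
    ‖toL2 (trig n c₀ c s)‖ ^ 2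
      = 2 * Real.pi * c₀ ^ 2 + Real.pi * ∑ k ∈ Finset.Icc 1 n, (c k ^ 2 + s k ^ 2) := by
  rw [← real_inner_self_eq_norm_sq, inner_trig]
  simp only [pow_two]

/-- A vector is orthogonal to `X_n` if it is orthogonal to `1` and to all derivatives of
trigonometric polynomials. -/
theorem mem_X_orthogonal_of_deriv {n : ℕ} {φ : L2} (h1 : inner ℝ φ (toL2 1) = 0)
    (h2 : ∀ c s : ℕ → ℝ, inner ℝ φ
      (toL2 (trig n 0 (fun k => k * s k) (fun k => -(k * c k)))) = 0) : φ ∈ (X n)ᗮ := by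
  rw [Submodule.mem_orthogonal']
  intro v hv
  obtain ⟨c₀, c, s, rfl⟩ := exists_trig_of_mem_X hv
  -- These are the coefficients of a primitive: every trigonometric polynomial of mean zero is a
  -- derivative.
  have h3 := h2 (fun k => -(s k / k)) (fun k => c k / k)
  have : trig n c₀ c s = c₀ • 1 +
      trig n 0 (fun k => k * (c k / k)) (fun k => -(k * (-(s k / k)))) := by
    ext x
    simp only [ContinuousMap.add_apply, trig_apply, ContinuousMap.smul_apply,
      ContinuousMap.one_apply, smul_eq_mul, mul_one, zero_add]
    congr 1
    refine Finset.sum_congr rfl fun k hk => ?_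
    have : (k : ℝ) ≠ 0 := by have := (Finset.mem_Icc.1 hk).1; positivity
    field_simp
  rw [this, map_add, inner_add_right, h3, map_smul, inner_smul_right, h1, mul_zero, add_zero]

/-! ### Primitives, integration by parts and the semigroup structure of `A`. -/

theorem integrable_indicator_L2 (φ : L2) :
    Integrable ((Ioo 0 (2 * Real.pi)).indicator φ) :=
  (integrable_indicator_iff measurableSet_Ioo).2 (integrable_L2 φ)

/-- The primitive `x ↦ ∫₀ˣ φ(t) dt` of a function in `L²(0, 2π)`, which is extended by zero. -/
noncomputable def prim (φ : L2) : C(ℝ, ℝ) :=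
  ⟨fun x => ∫ t in (0 : ℝ)..x, (Ioo 0 (2 * Real.pi)).indicator φ t,
    intervalIntegral.continuous_primitive
      (fun _ _ => (integrable_indicator_L2 φ).intervalIntegrable) 0⟩

theorem prim_apply (φ : L2) (x : ℝ) :
    prim φ x = ∫ t in (0 : ℝ)..x, (Ioo 0 (2 * Real.pi)).indicator φ t := rfl

theorem integral_indicator_Ioo (φ : ℝ → ℝ) {x : ℝ} (hx : x ∈ Icc 0 (2 * Real.pi)) :
    ∫ t in (0 : ℝ)..x, (Ioo 0 (2 * Real.pi)).indicator φ t = ∫ t in Ioo 0 x, φ t := by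
  rw [intervalIntegral.integral_of_le hx.1, integral_Ioc_eq_integral_Ioo]
  refine setIntegral_congr_fun measurableSet_Ioo fun t ht => ?_
  exact indicator_of_mem (Ioo_subset_Ioo_right hx.2 ht) _

theorem prim_eq (φ : L2) {x : ℝ} (hx : x ∈ Icc 0 (2 * Real.pi)) :
    prim φ x = ∫ t in Ioo 0 x, φ t := integral_indicator_Ioo φ hx

theorem A_apply_ae (p : ℕ) (φ : L2) : A p φ =ᵐ[mu] volterraFun p φ :=
  MemLp.coeFn_toLp (volterraFun_memLp p φ)

theorem A_one (φ : L2) : A 1 φ = toL2 (prim φ) := by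
  refine Lp.ext ?_
  filter_upwards [A_apply_ae 1 φ, toL2_ae (prim φ), ae_restrict_mem measurableSet_Ioo]
    with x h1 h2 hx
  rw [h1, h2, prim_eq φ (Ioo_subset_Icc_self hx), volterraFun]
  simp

/-- Integration by parts for a primitive against a function of class `C¹`. -/
theorem integral_primitive_mul {φ G g : ℝ → ℝ} {a : ℝ}
    (hφ : IntervalIntegrable φ volume 0 a) (hg : Continuous g)
    (hG : ∀ x, HasDerivAt G (g x) x) :
    ∫ t in (0 : ℝ)..a, (∫ s in (0 : ℝ)..t, φ s) * g t
      = (∫ s in (0 : ℝ)..a, φ s) * G a - ∫ s in (0 : ℝ)..a, φ s * G s := by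
  have hdG : deriv G = g := funext fun x => (hG x).deriv
  have hG1 : ContDiff ℝ 1 G :=
    contDiff_one_iff_deriv.2 ⟨fun x => (hG x).differentiableAt, hdG ▸ hg⟩
  -- The primitive is only absolutely continuous, with derivative `φ` almost everywhere, so the
  -- classical formula for `C¹` functions does not apply.
  have h := (hφ.absolutelyContinuousOnInterval_intervalIntegral
    left_mem_uIcc).integral_mul_deriv_eq_deriv_mul hG1.contDiffOn.absolutelyContinuousOnInterval
  simp only [hdG, intervalIntegral.integral_same, zero_mul, sub_zero] at h
  rw [h]
  congr 1
  refine intervalIntegral.integral_congr_ae ?_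
  filter_upwards [hφ.ae_hasDerivAt_integral] with x hx hx'
  rw [(hx (uIoc_subset_uIcc hx') 0 left_mem_uIcc).deriv]

/-- Integration by parts in `t`: the lower-order kernel is the `t`-derivative of minus the
higher-order one, which vanishes at `t = x`, while the primitive vanishes at `t = 0`. -/
theorem volterraFun_succ (p : ℕ) (φ : L2) {x : ℝ} (hx : x ∈ Ioo 0 (2 * Real.pi)) :
    volterraFun (p + 2) φ x = volterraFun (p + 1) (prim φ) x := by
  have hG : ∀ t, HasDerivAt (fun t : ℝ => -((x - t) ^ (p + 1) / ((p + 1 : ℕ).factorial : ℝ)))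
      ((x - t) ^ p / (p.factorial : ℝ)) t := by
    intro t
    have h1 : HasDerivAt (fun t : ℝ => x - t) (-1) t := by
      simpa using (hasDerivAt_id t).const_sub x
    refine (((h1.pow (p + 1)).div_const _).neg).congr_deriv ?_
    have : (p.factorial : ℝ) ≠ 0 := by positivity
    rw [Nat.factorial_succ]
    push_cast
    field_simp
  have h := integral_primitive_mul (a := x) (integrable_indicator_L2 φ).intervalIntegrable
    (g := fun t => (x - t) ^ p / (p.factorial : ℝ)) (by fun_prop) hG
  have e1 : volterraFun (p + 1) (prim φ) x
      = ∫ t in (0 : ℝ)..x, prim φ t * ((x - t) ^ p / (p.factorial : ℝ)) := by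
    rw [volterraFun, ← integral_const_mul, intervalIntegral.integral_of_le hx.1.le,
      integral_Ioc_eq_integral_Ioo]
    congr 1
    ext t
    simp
    ring
  have e2 : volterraFun (p + 2) φ x = ∫ t in (0 : ℝ)..x,
      (Ioo 0 (2 * Real.pi)).indicator
        (fun t => φ t * ((x - t) ^ (p + 1) / ((p + 1 : ℕ).factorial : ℝ))) t := by
    rw [integral_indicator_Ioo _ (Ioo_subset_Icc_self hx), volterraFun, ← integral_const_mul]
    congr 1
    ext t
    simp
    ring
  simp only [← prim_apply] at h
  rw [e1, h, e2]
  simp only [sub_self, ne_eq, Nat.succ_ne_zero, not_false_eq_true, zero_pow, zero_div, neg_zero,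
    mul_zero, zero_sub, mul_neg, intervalIntegral.integral_neg, neg_neg]
  congr 1
  ext t
  by_cases ht : t ∈ Ioo 0 (2 * Real.pi) <;> simp [ht]

theorem A_succ (p : ℕ) (φ : L2) : A (p + 2) φ = A (p + 1) (A 1 φ) := by
  refine Lp.ext ?_
  filter_upwards [A_apply_ae (p + 2) φ, A_apply_ae (p + 1) (A 1 φ),
    ae_restrict_mem measurableSet_Ioo] with x h1 h2 hx
  rw [h1, h2, volterraFun_succ p φ hx, A_one]
  exact (volterraFun_congr _ (toL2_ae (prim φ)) hx).symm

theorem A_one_toL2 {f F : C(ℝ, ℝ)} (h : ∀ x, HasDerivAt F (f x) x) :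
    A 1 (toL2 f) = toL2 F - F 0 • toL2 1 := by
  rw [A_one, ← map_smul, ← map_sub]
  refine toL2_eq_of_eqOn fun x hx => ?_
  rw [prim_apply, intervalIntegral.integral_congr_ae (g := f)]
  · rw [intervalIntegral.integral_eq_sub_of_hasDerivAt (fun x _ => h x)
      (f.continuous.intervalIntegrable _ _)]
    simp
  · have := (ae_restrict_iff' measurableSet_Ioo).1 (toL2_ae f)
    filter_upwards [this, Measure.ae_ne volume x] with t ht htx ht'
    rw [uIoc_of_le hx.1.le] at ht'
    have h2 : t ∈ Ioo 0 (2 * Real.pi) := ⟨ht'.1, ht'.2.trans_lt hx.2⟩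
    rw [indicator_of_mem h2, ht h2]

theorem inner_toL2_one (φ : L2) : inner ℝ φ (toL2 1) = prim φ (2 * Real.pi) := by
  rw [inner_toL2_right, prim_eq φ (right_mem_Icc.2 two_pi_nonneg)]
  simp

/-- Integration by parts; the boundary term at `0` is absent because the primitive vanishes there,
and the one at `2π` carries the integral of `φ`. -/
theorem inner_A_one (φ : L2) {G g : C(ℝ, ℝ)} (h : ∀ x, HasDerivAt G (g x) x) :
    inner ℝ (A 1 φ) (toL2 g)
      = inner ℝ φ (toL2 1) * G (2 * Real.pi) - inner ℝ φ (toL2 G) := by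
  rw [A_one, inner_toL2, inner_toL2_one, inner_toL2_right]
  simp only [prim_apply]
  rw [integral_primitive_mul (integrable_indicator_L2 φ).intervalIntegrable g.continuous h,
    ← integral_indicator_Ioo _ (right_mem_Icc.2 two_pi_nonneg)]
  congr 2
  ext t
  by_cases ht : t ∈ Ioo 0 (2 * Real.pi) <;> simp [ht]

/-- If `u₀, u₁, …` are successive derivatives and `u₀, …, u_{p-1}` vanish at `0`, then
`A⁽ᵖ⁾ u_p = u₀`. -/
theorem A_toL2_chain (p : ℕ) (u : ℕ → C(ℝ, ℝ)) (hu : ∀ j x, HasDerivAt (u j) (u (j + 1) x) x)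
    (h0 : ∀ j ≤ p, u j 0 = 0) : A (p + 1) (toL2 (u (p + 1))) = toL2 (u 0) := by
  induction p with
  | zero => rw [zero_add, A_one_toL2 (hu 0), h0 0 le_rfl, zero_smul, sub_zero]
  | succ p ih =>
    rw [A_succ, A_one_toL2 (hu (p + 1)), h0 (p + 1) le_rfl, zero_smul, sub_zero]
    exact ih fun j hj => h0 j (by omega)

/-! ## Successive derivatives of trigonometric polynomials -/

/-- Cosine and sine coefficients of the `j`-th derivative of `∑ (c_k cos kx + s_k sin kx)`. -/
noncomputable def derivCoeff (c s : ℕ → ℝ) : ℕ → (ℕ → ℝ) × (ℕ → ℝ)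
  | 0 => (c, s)
  | j + 1 => (fun k => k * (derivCoeff c s j).2 k, fun k => -(k * (derivCoeff c s j).1 k))

/-- The `j`-th derivative of a trigonometric polynomial. -/
noncomputable def trigDeriv (n : ℕ) (c₀ : ℝ) (c s : ℕ → ℝ) (j : ℕ) : C(ℝ, ℝ) :=
  trig n (if j = 0 then c₀ else 0) (derivCoeff c s j).1 (derivCoeff c s j).2

theorem hasDerivAt_trigDeriv (n : ℕ) (c₀ : ℝ) (c s : ℕ → ℝ) (j : ℕ) (x : ℝ) :
    HasDerivAt (trigDeriv n c₀ c s j) (trigDeriv n c₀ c s (j + 1) x) x :=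
  hasDerivAt_trig n _ _ _ x

theorem trigDeriv_mem_X (n : ℕ) (c₀ : ℝ) (c s : ℕ → ℝ) (j : ℕ) :
    toL2 (trigDeriv n c₀ c s j) ∈ X n := trig_mem_X _ _ _ _

/-- Bernstein's inequality in `L²`: differentiation multiplies the size of the `k`-th coefficient
pair by `k ≤ n`. -/
theorem norm_trigDeriv_succ_le (n : ℕ) (c₀ : ℝ) (c s : ℕ → ℝ) (j : ℕ) :
    ‖toL2 (trigDeriv n c₀ c s (j + 1))‖ ≤ n * ‖toL2 (trigDeriv n c₀ c s j)‖ := by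
  refine le_of_sq_le_sq ?_ (by positivity)
  rw [mul_pow, trigDeriv, trigDeriv, norm_sq_trig, norm_sq_trig, mul_add]
  have hpi := Real.pi_pos
  simp only [Nat.succ_ne_zero, if_false, ne_eq, OfNat.ofNat_ne_zero, not_false_eq_true, zero_pow,
    mul_zero, zero_add]
  refine le_add_of_nonneg_of_le (by positivity) ?_
  rw [mul_left_comm, Finset.mul_sum (a := (n : ℝ) ^ 2)]
  refine mul_le_mul_of_nonneg_left (Finset.sum_le_sum fun k hk => ?_) hpi.le
  have hkn : (k : ℝ) ^ 2 ≤ (n : ℝ) ^ 2 :=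
    pow_le_pow_left₀ (by positivity) (by exact_mod_cast (Finset.mem_Icc.1 hk).2) 2
  calc _ = (k : ℝ) ^ 2 * ((derivCoeff c s j).1 k ^ 2 + (derivCoeff c s j).2 k ^ 2) := by
        simp only [derivCoeff]; ring
    _ ≤ _ := mul_le_mul_of_nonneg_right hkn (by positivity)

theorem norm_trigDeriv_le (n : ℕ) (c₀ : ℝ) (c s : ℕ → ℝ) (j : ℕ) :
    ‖toL2 (trigDeriv n c₀ c s j)‖ ≤ (n : ℝ) ^ j * ‖toL2 (trig n c₀ c s)‖ := by
  induction j with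
  | zero => simp [trigDeriv, derivCoeff]
  | succ j ih =>
    refine (norm_trigDeriv_succ_le n c₀ c s j).trans ?_
    rw [pow_succ', mul_assoc]
    exact mul_le_mul_of_nonneg_left ih (by positivity)

/-- The Dirichlet kernel `1/2 + ∑ cos kx` and its derivatives. -/
noncomputable def dirichlet (n : ℕ) (j : ℕ) : C(ℝ, ℝ) := trigDeriv n (1 / 2) 1 0 j

/-- Up to the factor `π`, the Dirichlet kernel is the reproducing kernel of `X n` at the point `0`.
-/
theorem inner_trig_dirichlet (n : ℕ) (c₀ : ℝ) (c s : ℕ → ℝ) :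
    inner ℝ (toL2 (trig n c₀ c s)) (toL2 (dirichlet n 0)) = Real.pi * trig n c₀ c s 0 := by
  rw [dirichlet, trigDeriv, inner_trig, trig_zero]
  simp only [if_true, derivCoeff, Pi.one_apply, Pi.zero_apply, mul_one, mul_zero, add_zero]
  ring

theorem norm_dirichlet_zero (n : ℕ) : ‖toL2 (dirichlet n 0)‖ = √(Real.pi * (n + 1 / 2)) := by
  symm
  rw [Real.sqrt_eq_iff_mul_self_eq (by have := Real.pi_pos; positivity) (norm_nonneg _),
    ← pow_two, dirichlet, trigDeriv, norm_sq_trig]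
  simp [derivCoeff]
  ring

theorem norm_dirichlet_le (n j : ℕ) :
    ‖toL2 (dirichlet n j)‖ ≤ (n : ℝ) ^ j * √(Real.pi * (n + 1 / 2)) := by
  rw [← norm_dirichlet_zero]
  exact norm_trigDeriv_le n _ _ _ j

/-- Cauchy–Schwarz against the reproducing kernel; the constant is the norm of evaluation at `0` on
`X n`, and it sets the scale of all later estimates. -/
theorem abs_trig_zero_le (n : ℕ) (c₀ : ℝ) (c s : ℕ → ℝ) :
    |trig n c₀ c s 0| ≤ √((n + 1 / 2) / Real.pi) * ‖toL2 (trig n c₀ c s)‖ := by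
  have hpi := Real.pi_pos
  have h := abs_real_inner_le_norm (toL2 (trig n c₀ c s)) (toL2 (dirichlet n 0))
  rw [inner_trig_dirichlet, norm_dirichlet_zero, abs_mul, abs_of_pos hpi] at h
  have h2 : √(Real.pi * (n + 1 / 2)) = Real.pi * √((n + 1 / 2) / Real.pi) := by
    rw [Real.sqrt_eq_iff_mul_self_eq (by positivity) (by positivity), mul_mul_mul_comm,
      Real.mul_self_sqrt (by positivity)]
    field_simp
  rw [h2] at h
  refine le_of_mul_le_mul_left (h.trans_eq ?_) hpi
  ring

/-! ## Fourier remainders of polynomials -/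

/-- The tail `∑_{k > n} 1/k²`. -/
noncomputable def tailSq (n : ℕ) : ℝ :=
  Real.pi ^ 2 / 6 - ∑ k ∈ Finset.Icc 1 n, 1 / (k : ℝ) ^ 2

theorem tailSq_nonneg (n : ℕ) : 0 ≤ tailSq n :=
  sub_nonneg.2 (sum_le_hasSum _ (fun _ _ => by positivity) hasSum_zeta_two)

/-- Telescoping, from `1/k² ≤ 1/(k² - 1/4) = 1/(k - 1/2) - 1/(k + 1/2)`. The shift by `1/2` gives
exactly `ν ≤ 1`, on which the linear systems below rely. -/
theorem tailSq_le (n : ℕ) : tailSq n ≤ 1 / (n + 1 / 2) := by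
  have hstep : ∀ m : ℕ, (∑ k ∈ Finset.Icc 1 (n + m), 1 / (k : ℝ) ^ 2) + 1 / (((n + m : ℕ) : ℝ) + 1 / 2)
      ≤ (∑ k ∈ Finset.Icc 1 n, 1 / (k : ℝ) ^ 2) + 1 / (n + 1 / 2) := by
    intro m
    induction m with
    | zero => exact le_of_eq (by simp)
    | succ m ih =>
      refine le_trans ?_ ih
      rw [← add_assoc n m 1, Finset.sum_Icc_succ_top (by omega), add_assoc]
      refine add_le_add_right ?_ _
      generalize n + m = k
      push_cast
      have hk : (0 : ℝ) ≤ k := by positivity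
      rw [div_add_div _ _ (by positivity) (by positivity),
        div_le_div_iff₀ (by positivity) (by positivity)]
      nlinarith
  have hlim : Filter.Tendsto (fun m => ∑ k ∈ Finset.Icc 1 (n + m), 1 / (k : ℝ) ^ 2) Filter.atTop
      (nhds (Real.pi ^ 2 / 6)) := by
    have h := (hasSum_zeta_two.tendsto_sum_nat).comp
      (Filter.tendsto_add_atTop_nat (n + 1))
    refine h.congr fun m => ?_
    rw [Function.comp_apply, show m + (n + 1) = (n + m) + 1 by omega, Finset.sum_range_succ',
      Finset.range_eq_Ico, Finset.sum_Ico_add' (fun k : ℕ => 1 / (k : ℝ) ^ 2) 0 (n + m) 1]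
    simp only [Nat.cast_zero, ne_eq, OfNat.ofNat_ne_zero, not_false_eq_true, zero_pow, div_zero,
      add_zero, zero_add]
    rfl
  unfold tailSq
  rw [sub_le_iff_le_add']
  refine le_of_tendsto' hlim fun m => le_trans ?_ (hstep m)
  exact le_add_of_nonneg_right (by positivity)

/-- Three successive derivatives of `∑_{k > n} sin kx / k³`, followed by the negative Dirichlet
kernel and its derivatives: for `x ∈ (0, 2π)` and `j < 3`, `remainder n j x` is the `j`-th derivative
of the Fourier remainder of order `n` of a polynomial of degree three. -/
noncomputable def remainder (n : ℕ) : ℕ → C(ℝ, ℝ)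
  | 0 => ⟨fun x => (x - Real.pi) ^ 3 / 12 - Real.pi ^ 2 / 12 * (x - Real.pi), by fun_prop⟩
      + trig n 0 0 (fun k => -(1 / (k : ℝ) ^ 3))
  | 1 => ⟨fun x => (x - Real.pi) ^ 2 / 4 - Real.pi ^ 2 / 12, by fun_prop⟩
      + trig n 0 (fun k => -(1 / (k : ℝ) ^ 2)) 0
  | 2 => ⟨fun x => (x - Real.pi) / 2, by fun_prop⟩ + trig n 0 0 (fun k => 1 / (k : ℝ))
  | j + 3 => dirichlet n j

theorem trig_congr {n : ℕ} (c₀ : ℝ) {c s d t : ℕ → ℝ}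
    (hc : ∀ k ∈ Finset.Icc 1 n, c k = d k) (hs : ∀ k ∈ Finset.Icc 1 n, s k = t k) :
    trig n c₀ c s = trig n c₀ d t := by
  ext x
  rw [trig_apply, trig_apply]
  exact congrArg _ (Finset.sum_congr rfl fun k hk => by rw [hc k hk, hs k hk])

theorem hasDerivAt_trig_of_eq {n : ℕ} {c₀ : ℝ} {c s d t : ℕ → ℝ}
    (hc : ∀ k ∈ Finset.Icc 1 n, k * s k = d k) (hs : ∀ k ∈ Finset.Icc 1 n, -(k * c k) = t k)
    (x : ℝ) : HasDerivAt (trig n c₀ c s) (trig n 0 d t x) x := by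
  rw [← trig_congr 0 hc hs]
  exact hasDerivAt_trig n c₀ c s x

theorem ne_zero_of_mem_Icc {n k : ℕ} (hk : k ∈ Finset.Icc 1 n) : (k : ℝ) ≠ 0 := by
  have := (Finset.mem_Icc.1 hk).1
  positivity

theorem hasDerivAt_remainder (n j : ℕ) (x : ℝ) :
    HasDerivAt (remainder n j) (remainder n (j + 1) x) x := by
  have h1 : HasDerivAt (fun x : ℝ => x - Real.pi) 1 x := (hasDerivAt_id x).sub_const _
  match j with
  | 0 =>
    refine HasDerivAt.add (f := fun x => (x - Real.pi) ^ 3 / 12 - Real.pi ^ 2 / 12 * (x - Real.pi))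
      (((((h1.pow 3).div_const 12).sub (h1.const_mul (Real.pi ^ 2 / 12))).congr_deriv ?_))
      (hasDerivAt_trig_of_eq (fun k hk => ?_) (fun k hk => ?_) x)
    · simp; ring
    · have := ne_zero_of_mem_Icc hk
      field_simp
    · simp
  | 1 =>
    refine HasDerivAt.add (f := fun x => (x - Real.pi) ^ 2 / 4 - Real.pi ^ 2 / 12)
      (((((h1.pow 2).div_const 4).sub_const (Real.pi ^ 2 / 12)).congr_deriv ?_))
      (hasDerivAt_trig_of_eq (fun k hk => ?_) (fun k hk => ?_) x)
    · simp; ring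
    · simp
    · have := ne_zero_of_mem_Icc hk
      field_simp
  | 2 =>
    have h2 : HasDerivAt (trig n 0 0 (fun k => 1 / (k : ℝ))) (trig n 0 1 0 x) x :=
      hasDerivAt_trig_of_eq (fun k hk => by
        have := ne_zero_of_mem_Icc hk
        simp [this]) (fun k hk => by simp) x
    refine (HasDerivAt.add (f := fun x => (x - Real.pi) / 2) (h1.div_const 2) h2).congr_deriv ?_
    simp [remainder, dirichlet, trigDeriv, trig_apply, derivCoeff]
  | j + 3 => exact hasDerivAt_trigDeriv n _ _ _ j x

theorem remainder_zero_zero (n : ℕ) : remainder n 0 0 = 0 := by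
  simp only [remainder, ContinuousMap.add_apply, ContinuousMap.coe_mk, trig_zero]
  simp
  ring

theorem remainder_one_zero (n : ℕ) : remainder n 1 0 = tailSq n := by
  simp only [remainder, ContinuousMap.add_apply, ContinuousMap.coe_mk, trig_zero, tailSq,
    Finset.sum_neg_distrib]
  ring

theorem remainder_two_zero (n : ℕ) : remainder n 2 0 = -(Real.pi / 2) := by
  simp only [remainder, ContinuousMap.add_apply, ContinuousMap.coe_mk, trig_zero]
  simp
  ring

theorem remainder_three_zero (n : ℕ) : remainder n 3 0 = n + 1 / 2 := by
  simp [remainder, dirichlet, trigDeriv, trig_zero, derivCoeff]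
  ring

theorem remainder_four_zero (n : ℕ) : remainder n 4 0 = 0 := by
  simp [remainder, dirichlet, trigDeriv, trig_zero, derivCoeff]

theorem remainder_zero_two_pi (n : ℕ) : remainder n 0 (2 * Real.pi) = 0 := by
  simp only [remainder, ContinuousMap.add_apply, ContinuousMap.coe_mk, trig_two_pi, trig_zero]
  simp
  ring

theorem remainder_one_two_pi (n : ℕ) : remainder n 1 (2 * Real.pi) = tailSq n := by
  rw [← remainder_one_zero]
  simp only [remainder, ContinuousMap.add_apply, ContinuousMap.coe_mk, trig_two_pi]
  ring

theorem remainder_two_two_pi (n : ℕ) : remainder n 2 (2 * Real.pi) = Real.pi / 2 := by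
  simp only [remainder, ContinuousMap.add_apply, ContinuousMap.coe_mk, trig_two_pi, trig_zero]
  simp
  ring

theorem inner_toL2_one_of_deriv {F f : C(ℝ, ℝ)} (h : ∀ x, HasDerivAt F (f x) x) :
    inner ℝ (toL2 f) (toL2 1) = F (2 * Real.pi) - F 0 := by
  rw [inner_toL2]
  simp only [ContinuousMap.one_apply, mul_one]
  exact intervalIntegral.integral_eq_sub_of_hasDerivAt (fun x _ => h x)
    (f.continuous.intervalIntegrable _ _)

theorem inner_toL2_deriv {F f G g : C(ℝ, ℝ)} (hF : ∀ x, HasDerivAt F (f x) x)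
    (hG : ∀ x, HasDerivAt G (g x) x) : inner ℝ (toL2 F) (toL2 g)
      = F (2 * Real.pi) * G (2 * Real.pi) - F 0 * G 0 - inner ℝ (toL2 f) (toL2 G) := by
  rw [inner_toL2, inner_toL2]
  exact intervalIntegral.integral_mul_deriv_eq_deriv_mul (fun x _ => hF x) (fun x _ => hG x)
    (f.continuous.intervalIntegrable _ _) (g.continuous.intervalIntegrable _ _)

/-- The periodic primitive of mean zero of a function orthogonal to `X_n` is orthogonal to `X_n`. -/
theorem mem_X_orthogonal_of_hasDerivAt {n : ℕ} {F f : C(ℝ, ℝ)} (h : ∀ x, HasDerivAt F (f x) x)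
    (hf : toL2 f ∈ (X n)ᗮ) (hper : F (2 * Real.pi) = F 0)
    (h1 : inner ℝ (toL2 F) (toL2 1) = 0) : toL2 F ∈ (X n)ᗮ := by
  refine mem_X_orthogonal_of_deriv h1 fun c s => ?_
  rw [inner_toL2_deriv h (hasDerivAt_trig n 0 c s), hper, trig_two_pi, sub_self, zero_sub,
    (Submodule.mem_orthogonal' _ _).1 hf _ (trig_mem_X _ _ _ _), neg_zero]

/-- Against the derivative of a trigonometric polynomial `T`, the jump `π` between the endpoint
values produces `π T(0)`, and the Dirichlet kernel, being the derivative of this remainder,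
reproduces the same value with the opposite sign. -/
theorem remainder_two_mem (n : ℕ) : toL2 (remainder n 2) ∈ (X n)ᗮ := by
  refine mem_X_orthogonal_of_deriv ?_ fun c s => ?_
  · rw [inner_toL2_one_of_deriv (hasDerivAt_remainder n 1), remainder_one_two_pi,
      remainder_one_zero, sub_self]
  · rw [inner_toL2_deriv (hasDerivAt_remainder n 2) (hasDerivAt_trig n 0 c s),
      show remainder n (2 + 1) = dirichlet n 0 from rfl, real_inner_comm, inner_trig_dirichlet,
      trig_two_pi, remainder_two_two_pi, remainder_two_zero]
    ring

theorem remainder_one_mem (n : ℕ) : toL2 (remainder n 1) ∈ (X n)ᗮ := by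
  refine mem_X_orthogonal_of_hasDerivAt (hasDerivAt_remainder n 1) (remainder_two_mem n) ?_ ?_
  · rw [remainder_one_two_pi, remainder_one_zero]
  · rw [inner_toL2_one_of_deriv (hasDerivAt_remainder n 0), remainder_zero_two_pi,
      remainder_zero_zero, sub_self]

theorem remainder_zero_mem (n : ℕ) : toL2 (remainder n 0) ∈ (X n)ᗮ := by
  refine mem_X_orthogonal_of_hasDerivAt (hasDerivAt_remainder n 0) (remainder_one_mem n) ?_ ?_
  · rw [remainder_zero_two_pi, remainder_zero_zero]
  -- Mean zero is read off from an explicit antiderivative taking equal values at `0` and `2π`.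
  · have h : ∀ x, HasDerivAt
        ((⟨fun x => (x - Real.pi) ^ 4 / 48 - Real.pi ^ 2 / 24 * (x - Real.pi) ^ 2, by fun_prop⟩
          : C(ℝ, ℝ)) + trig n 0 (fun k => 1 / (k : ℝ) ^ 4) 0 : C(ℝ, ℝ)) (remainder n 0 x) x := by
      intro x
      have h1 : HasDerivAt (fun x : ℝ => x - Real.pi) 1 x := (hasDerivAt_id x).sub_const _
      refine HasDerivAt.add
        (f := fun x => (x - Real.pi) ^ 4 / 48 - Real.pi ^ 2 / 24 * (x - Real.pi) ^ 2)
        (((((h1.pow 4).div_const 48).sub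
          ((h1.pow 2).const_mul (Real.pi ^ 2 / 24))).congr_deriv ?_))
        (hasDerivAt_trig_of_eq (fun k hk => ?_) (fun k hk => ?_) x)
      · simp; ring
      · simp
      · have := ne_zero_of_mem_Icc hk
        field_simp
    rw [inner_toL2_one_of_deriv h]
    simp only [ContinuousMap.add_apply, ContinuousMap.coe_mk, trig_two_pi]
    ring

/-- By orthogonality, one factor may be replaced by its polynomial part `(x - π)/2`. Integrating by
parts leaves only boundary values of `remainder n 1`, because that function has mean zero. -/
theorem norm_sq_remainder_two (n : ℕ) : ‖toL2 (remainder n 2)‖ ^ 2 = Real.pi * tailSq n := by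
  have h : ∀ x, HasDerivAt (⟨fun x => (x - Real.pi) / 2, by fun_prop⟩ : C(ℝ, ℝ))
      ((⟨fun _ => 1 / 2, by fun_prop⟩ : C(ℝ, ℝ)) x) x :=
    fun x => ((hasDerivAt_id x).sub_const _).div_const 2
  have hhalf : toL2 (⟨fun _ => 1 / 2, by fun_prop⟩ : C(ℝ, ℝ)) = (1 / 2 : ℝ) • toL2 1 := by
    rw [← map_smul]
    exact toL2_eq_of_eqOn fun x _ => by simp
  have h2 := inner_toL2_deriv h (hasDerivAt_remainder n 1)
  rw [hhalf, inner_smul_left, (Submodule.mem_orthogonal _ _).1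
    (remainder_one_mem n) _ (toL2_one_mem_X n), mul_zero, sub_zero, remainder_one_two_pi,
    remainder_one_zero] at h2
  rw [← real_inner_self_eq_norm_sq]
  conv_lhs => rw [remainder, map_add, inner_add_left]
  have h3 := (Submodule.mem_orthogonal _ _).1 (remainder_two_mem n) _
    (trig_mem_X n 0 0 (fun k => 1 / (k : ℝ)))
  rw [remainder, map_add] at h2 h3
  rw [h2, h3]
  simp only [ContinuousMap.coe_mk]
  ring

/-! ## Solving the Galerkin equation for smooth right-hand sides -/

/-- The `j`-th derivative of a combination of the Fourier remainders of three polynomials. -/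
noncomputable def remainderComb (n : ℕ) (a b c : ℝ) (j : ℕ) : C(ℝ, ℝ) :=
  a • remainder n (j + 2) + b • remainder n (j + 1) + c • remainder n j

theorem remainderComb_apply (n : ℕ) (a b c : ℝ) (j : ℕ) (x : ℝ) : remainderComb n a b c j x =
    a * remainder n (j + 2) x + b * remainder n (j + 1) x + c * remainder n j x := rfl

theorem remainderComb_zero_mem (n : ℕ) (a b c : ℝ) :
    toL2 (remainderComb n a b c 0) ∈ (X n)ᗮ := by
  rw [remainderComb, map_add, map_add, map_smul, map_smul, map_smul]
  exact add_mem (add_mem (Submodule.smul_mem _ _ (remainder_two_mem n))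
    (Submodule.smul_mem _ _ (remainder_one_mem n))) (Submodule.smul_mem _ _ (remainder_zero_mem n))

/-- Integrating `q + 1` times from `0` undoes `q + 1` differentiations exactly when all initial
values vanish; `h0` is the linear system to be solved for `a`, `b`, `c`. -/
theorem A_remainderComb (n q : ℕ) (a b c : ℝ) (g : ℕ → C(ℝ, ℝ))
    (hg : ∀ j x, HasDerivAt (g j) (g (j + 1) x) x)
    (h0 : ∀ j ≤ q, g j 0 + remainderComb n a b c j 0 = 0) :
    A (q + 1) (toL2 (remainderComb n a b c (q + 1)) + toL2 (g (q + 1)))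
      = toL2 (g 0) + toL2 (remainderComb n a b c 0) := by
  rw [add_comm (toL2 _), ← map_add, ← map_add]
  refine A_toL2_chain q (fun j => g j + remainderComb n a b c j) (fun j x => ?_) h0
  exact (hg j x).add ((((hasDerivAt_remainder n (j + 2) x).const_smul a).add
    ((hasDerivAt_remainder n (j + 1) x).const_smul b)).add
    ((hasDerivAt_remainder n j x).const_smul c))

/-- The weight `√(N/π)` times the norm `√(πN)` of the Dirichlet kernel is `N`; each further
derivative costs at most another `N`. -/
theorem smul_dirichlet_le (n j : ℕ) (t : ℝ) :
    ‖(√((n + 1 / 2) / Real.pi) * t) • toL2 (dirichlet n j)‖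
      ≤ |t| * ((n : ℝ) + 1 / 2) ^ (j + 1) := by
  have hpi := Real.pi_pos
  have h1 : √((n + 1 / 2) / Real.pi) * √(Real.pi * (n + 1 / 2)) = (n : ℝ) + 1 / 2 := by
    rw [← Real.sqrt_mul (by positivity), Real.sqrt_eq_iff_mul_self_eq (by positivity)
      (by positivity)]
    field_simp
  have h2 : (n : ℝ) ^ j ≤ ((n : ℝ) + 1 / 2) ^ j := pow_le_pow_left₀ (by positivity) (by linarith) j
  rw [norm_smul, Real.norm_eq_abs, abs_mul, abs_of_nonneg (Real.sqrt_nonneg _)]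
  calc _ ≤ √((n + 1 / 2) / Real.pi) * |t| * ((n : ℝ) ^ j * √(Real.pi * (n + 1 / 2))) :=
        mul_le_mul_of_nonneg_left (norm_dirichlet_le n j) (by positivity)
    _ = |t| * ((n : ℝ) ^ j * (√((n + 1 / 2) / Real.pi) * √(Real.pi * (n + 1 / 2)))) := by ring
    _ = |t| * ((n : ℝ) ^ j * ((n : ℝ) + 1 / 2)) := by rw [h1]
    _ ≤ |t| * (((n : ℝ) + 1 / 2) ^ j * ((n : ℝ) + 1 / 2)) := by gcongr
    _ = _ := by rw [pow_succ]

/-- The rescaled system for `p = 2`. Its determinant `π²/4 - ν` exceeds `1.46` for `ν ≤ 1`. -/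
theorem exists_coeff_two {ν S y₀ y₁ : ℝ} (hν : 0 ≤ ν) (hν1 : ν ≤ 1)
    (h0 : |y₀| ≤ S) (h1 : |y₁| ≤ S) : ∃ t₁ t₂ : ℝ,
      y₀ - Real.pi / 2 * t₁ + ν * t₂ = 0 ∧ y₁ + t₁ - Real.pi / 2 * t₂ = 0 ∧
      |t₁| ≤ 9 / 5 * S ∧ |t₂| ≤ 9 / 5 * S := by
  have hp1 := Real.pi_gt_d2
  have hp2 := Real.pi_lt_d2
  have hS : 0 ≤ S := (abs_nonneg _).trans h0
  have hd : 1.464 < Real.pi ^ 2 / 4 - ν := by nlinarith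
  have e2 : (y₀ + Real.pi / 2 * y₁) / (Real.pi ^ 2 / 4 - ν) * (Real.pi ^ 2 / 4 - ν)
      = y₀ + Real.pi / 2 * y₁ := div_mul_cancel₀ _ (by linarith)
  set t₂ := (y₀ + Real.pi / 2 * y₁) / (Real.pi ^ 2 / 4 - ν) with ht₂
  have b2 : |t₂| ≤ 9 / 5 * S := by
    rw [ht₂, abs_div, abs_of_pos (show 0 < Real.pi ^ 2 / 4 - ν by linarith),
      div_le_iff₀ (by linarith)]
    calc |y₀ + Real.pi / 2 * y₁| ≤ |y₀| + Real.pi / 2 * |y₁| := by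
          refine (abs_add_le _ _).trans_eq ?_
          rw [abs_mul, abs_of_pos (show 0 < Real.pi / 2 by linarith)]
      _ ≤ S + 3.15 / 2 * S := by gcongr
      _ ≤ 9 / 5 * S * 1.464 := by nlinarith
      _ ≤ _ := by gcongr
  refine ⟨Real.pi / 2 * t₂ - y₁, t₂, ?_, by ring, ?_, b2⟩
  · linear_combination -e2
  -- Although `t₁` is defined by the second equation, the first one gives the better bound, since it
  -- divides by `π/2`.
  · have h3 : Real.pi / 2 * (Real.pi / 2 * t₂ - y₁) = y₀ + ν * t₂ := by linear_combination e2
    have h4 : |y₀ + ν * t₂| ≤ S + 1 * (9 / 5 * S) := by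
      refine (abs_add_le _ _).trans ?_
      rw [abs_mul, abs_of_nonneg hν]
      gcongr
    rw [← h3, abs_mul, abs_of_pos (show 0 < Real.pi / 2 by linarith)] at h4
    nlinarith [abs_nonneg (Real.pi / 2 * t₂ - y₁)]

/-- The rescaled system for `p = 3`, solved by elimination. Up to sign its determinant is `π/2 (π²/4
- 2ν)`, positive because `ν ≤ 1 < π²/8`. -/
theorem exists_coeff_three {ν S y₀ y₁ y₂ : ℝ} (hν : 0 ≤ ν) (hν1 : ν ≤ 1)
    (h0 : |y₀| ≤ S) (h1 : |y₁| ≤ S) (h2 : |y₂| ≤ S) : ∃ t₁ t₂ t₃ : ℝ,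
      y₀ - Real.pi / 2 * t₁ + ν * t₂ = 0 ∧ y₁ + t₁ - Real.pi / 2 * t₂ + ν * t₃ = 0 ∧
      y₂ + t₂ - Real.pi / 2 * t₃ = 0 ∧ |t₁| ≤ 9 * S ∧ |t₂| ≤ 13 * S ∧ |t₃| ≤ 7 * S := by
  have hp1 := Real.pi_gt_d2
  have hp2 := Real.pi_lt_d2
  have hS : 0 ≤ S := (abs_nonneg _).trans h0
  have hd : 0.4649 ≤ Real.pi ^ 2 / 4 - 2 * ν := by nlinarith
  have hd2 : Real.pi ^ 2 / 4 - ν ≤ 2.481 := by nlinarith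
  have hD : 0.7298 ≤ Real.pi / 2 * (Real.pi ^ 2 / 4 - 2 * ν) := by nlinarith
  set B := y₀ + Real.pi / 2 * y₁ + (Real.pi ^ 2 / 4 - ν) * y₂ with hB
  set D := Real.pi / 2 * (Real.pi ^ 2 / 4 - 2 * ν) with hDdef
  have e3 : B / D * D = B := div_mul_cancel₀ _ (by linarith)
  set t₃ := B / D with ht₃
  have b3 : |t₃| ≤ 7 * S := by
    rw [ht₃, abs_div, abs_of_pos (show 0 < D by linarith), div_le_iff₀ (by linarith)]
    calc |B| ≤ |y₀| + Real.pi / 2 * |y₁| + (Real.pi ^ 2 / 4 - ν) * |y₂| := by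
          refine (abs_add_three _ _ _).trans_eq ?_
          rw [abs_mul, abs_mul, abs_of_pos (show 0 < Real.pi / 2 by linarith),
            abs_of_pos (show 0 < Real.pi ^ 2 / 4 - ν by linarith)]
      _ ≤ S + 3.15 / 2 * S + 2.481 * S := by gcongr
      _ ≤ 7 * S * 0.7298 := by nlinarith
      _ ≤ _ := by gcongr
  have b2 : |Real.pi / 2 * t₃ - y₂| ≤ 13 * S := by
    refine (abs_sub _ _).trans ?_
    rw [abs_mul, abs_of_pos (show 0 < Real.pi / 2 by linarith)]
    nlinarith [abs_nonneg t₃]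
  set t₂ := Real.pi / 2 * t₃ - y₂ with ht₂
  refine ⟨Real.pi / 2 * t₂ - ν * t₃ - y₁, t₂, t₃, ?_, by ring, by rw [ht₂]; ring, ?_, b2, b3⟩
  · rw [ht₂]; linear_combination -e3
  · have h3 : Real.pi / 2 * (Real.pi / 2 * t₂ - ν * t₃ - y₁) = y₀ + ν * t₂ := by
      rw [ht₂]; linear_combination e3
    have h4 : |y₀ + ν * t₂| ≤ S + 1 * (13 * S) := by
      refine (abs_add_le _ _).trans ?_
      rw [abs_mul, abs_of_nonneg hν]
      gcongr
    rw [← h3, abs_mul, abs_of_pos (show 0 < Real.pi / 2 by linarith)] at h4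
    nlinarith [abs_nonneg (Real.pi / 2 * t₂ - ν * t₃ - y₁)]

/-- The constants in the stability estimate for the Galerkin equation. -/
noncomputable def stabConst : ℕ → ℝ
  | 1 => 1
  | 2 => 18 / 5
  | 3 => 29
  | _ => 0

/-- The core construction: `h` is a combination of Fourier remainders cancelling the initial values
of `g`, and `ψ` is its `p`-th derivative. The hypothesis `hS` has the scaling shared by
trigonometric polynomials and by the polynomials arising from `A p r`. -/
theorem exists_approx_solution {p n : ℕ} (hp : p = 1 ∨ p = 2 ∨ p = 3) (g : ℕ → C(ℝ, ℝ))
    (hg : ∀ j x, HasDerivAt (g j) (g (j + 1) x) x) {S : ℝ}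
    (hS : ∀ j < p, |g j 0| ≤ √((n + 1 / 2) / Real.pi) * ((n : ℝ) + 1 / 2) ^ j * S) :
    ∃ ψ ∈ X n, ∃ h ∈ (X n)ᗮ, A p (ψ + toL2 (g p)) = toL2 (g 0) + h ∧
      ‖ψ‖ ≤ stabConst p * (((n : ℝ) + 1 / 2) ^ p * S) := by
  have hpi := Real.pi_pos
  have hp1 := Real.pi_gt_d2
  have hN : 0 < (n : ℝ) + 1 / 2 := by positivity
  set N : ℝ := (n : ℝ) + 1 / 2 with hNdef
  set σ := √(N / Real.pi) with hσ
  have hσ0 : 0 < σ := Real.sqrt_pos.2 (by positivity)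
  set ν := N * tailSq n with hν
  have hν0 : 0 ≤ ν := mul_nonneg hN.le (tailSq_nonneg n)
  have hν1 : ν ≤ 1 := by
    have := mul_le_mul_of_nonneg_left (tailSq_le n) hN.le
    rwa [mul_one_div_cancel hN.ne'] at this
  -- With coefficients `σ t₁`, `N σ t₂`, `N² σ t₃`, dividing the `j`-th condition by `σ N^j` leaves
  -- a system involving only `π`, `ν` and the normalised values `y`.
  have hy : ∀ j < p, ∃ y, g j 0 = σ * N ^ j * y ∧ |y| ≤ S := by
    intro j hj
    have hpos : 0 < σ * N ^ j := by positivity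
    refine ⟨g j 0 / (σ * N ^ j), by rw [mul_div_cancel₀ _ hpos.ne'], ?_⟩
    rw [abs_div, abs_of_pos hpos, div_le_iff₀ hpos]
    exact (hS j hj).trans_eq (by ring)
  have r3 : remainder n 3 0 = N := remainder_three_zero n
  rcases hp with rfl | rfl | rfl
  · obtain ⟨y₀, hy₀, b₀⟩ := hy 0 (by norm_num)
    have hb : |y₀ / (Real.pi / 2)| ≤ S := by
      rw [abs_div, abs_of_pos (show 0 < Real.pi / 2 by linarith), div_le_iff₀ (by linarith)]
      nlinarith [abs_nonneg y₀]
    refine ⟨toL2 (remainderComb n (σ * (y₀ / (Real.pi / 2))) 0 0 1), ?_, _,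
      remainderComb_zero_mem n _ 0 0, A_remainderComb n 0 _ 0 0 g hg ?_, ?_⟩
    · rw [remainderComb, zero_smul, zero_smul, add_zero, add_zero, map_smul]
      exact Submodule.smul_mem _ _ (trigDeriv_mem_X _ _ _ _ _)
    · intro j hj
      obtain rfl : j = 0 := by omega
      rw [remainderComb_apply, remainder_two_zero, hy₀]
      field_simp
      ring
    · rw [remainderComb, zero_smul, zero_smul, add_zero, add_zero, map_smul]
      refine (smul_dirichlet_le n 0 _).trans ?_
      rw [stabConst, one_mul, mul_comm, zero_add]
      gcongr
  · obtain ⟨y₀, hy₀, b₀⟩ := hy 0 (by norm_num)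
    obtain ⟨y₁, hy₁, b₁⟩ := hy 1 (by norm_num)
    obtain ⟨t₁, t₂, e0, e1, bt₁, bt₂⟩ := exists_coeff_two hν0 hν1 b₀ b₁
    refine ⟨toL2 (remainderComb n (σ * t₁) (N * (σ * t₂)) 0 2), ?_, _,
      remainderComb_zero_mem n _ _ 0, A_remainderComb n 1 _ _ 0 g hg ?_, ?_⟩
    · rw [remainderComb, zero_smul, add_zero, map_add, map_smul, map_smul]
      exact add_mem (Submodule.smul_mem _ _ (trigDeriv_mem_X _ _ _ _ _))
        (Submodule.smul_mem _ _ (trigDeriv_mem_X _ _ _ _ _))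
    · intro j hj
      interval_cases j
      · rw [remainderComb_apply, remainder_two_zero, remainder_one_zero, hy₀]
        linear_combination σ * e0
      · rw [remainderComb_apply, remainder_two_zero, r3, hy₁]
        linear_combination σ * N * e1
    · rw [remainderComb, zero_smul, add_zero, map_add, map_smul, map_smul, mul_smul N]
      refine (norm_add_le _ _).trans ?_
      rw [norm_smul N, Real.norm_of_nonneg hN.le]
      have k1 := smul_dirichlet_le n 1 t₁
      have k2 := mul_le_mul_of_nonneg_left (smul_dirichlet_le n 0 t₂) hN.le
      refine (add_le_add k1 k2).trans ?_
      rw [← hNdef, stabConst]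
      calc |t₁| * N ^ (1 + 1) + N * (|t₂| * N ^ (0 + 1)) = (|t₁| + |t₂|) * N ^ 2 := by ring
        _ ≤ (9 / 5 * S + 9 / 5 * S) * N ^ 2 := by gcongr
        _ = _ := by ring
  · obtain ⟨y₀, hy₀, b₀⟩ := hy 0 (by norm_num)
    obtain ⟨y₁, hy₁, b₁⟩ := hy 1 (by norm_num)
    obtain ⟨y₂, hy₂, b₂⟩ := hy 2 (by norm_num)
    obtain ⟨t₁, t₂, t₃, e0, e1, e2, bt₁, bt₂, bt₃⟩ := exists_coeff_three hν0 hν1 b₀ b₁ b₂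
    refine ⟨toL2 (remainderComb n (σ * t₁) (N * (σ * t₂)) (N ^ 2 * (σ * t₃)) 3), ?_, _,
      remainderComb_zero_mem n _ _ _, A_remainderComb n 2 _ _ _ g hg ?_, ?_⟩
    · rw [remainderComb, map_add, map_add, map_smul, map_smul, map_smul]
      exact add_mem (add_mem (Submodule.smul_mem _ _ (trigDeriv_mem_X _ _ _ _ _))
        (Submodule.smul_mem _ _ (trigDeriv_mem_X _ _ _ _ _)))
        (Submodule.smul_mem _ _ (trigDeriv_mem_X _ _ _ _ _))
    · intro j hj
      interval_cases j
      · rw [remainderComb_apply, remainder_two_zero, remainder_one_zero, remainder_zero_zero, hy₀]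
        linear_combination σ * e0
      · rw [remainderComb_apply, remainder_two_zero, r3, remainder_one_zero, hy₁]
        linear_combination σ * N * e1
      · rw [remainderComb_apply, remainder_four_zero, r3, remainder_two_zero, hy₂]
        linear_combination σ * N ^ 2 * e2
    · rw [remainderComb, map_add, map_add, map_smul, map_smul, map_smul, mul_smul N,
        mul_smul (N ^ 2)]
      refine (norm_add₃_le).trans ?_
      rw [norm_smul N, norm_smul (N ^ 2), Real.norm_of_nonneg hN.le,
        Real.norm_of_nonneg (sq_nonneg N)]
      have k1 := smul_dirichlet_le n 2 t₁
      have k2 := mul_le_mul_of_nonneg_left (smul_dirichlet_le n 1 t₂) hN.le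
      have k3 := mul_le_mul_of_nonneg_left (smul_dirichlet_le n 0 t₃) (sq_nonneg N)
      refine (add_le_add (add_le_add k1 k2) k3).trans ?_
      rw [← hNdef, stabConst]
      calc |t₁| * N ^ (2 + 1) + N * (|t₂| * N ^ (1 + 1)) + N ^ 2 * (|t₃| * N ^ (0 + 1))
            = (|t₁| + |t₂| + |t₃|) * N ^ 3 := by ring
        _ ≤ (9 * S + 13 * S + 7 * S) * N ^ 3 := by gcongr
        _ = _ := by ring

/-! ## Invertibility of the Galerkin operator -/

theorem P_eq_of_sub_mem {n : ℕ} {φ : L2} {z : X n} (h : φ - z ∈ (X n)ᗮ) : P n φ = z :=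
  Subtype.ext ((X n).eq_starProjection_of_mem_orthogonal z.2 h)

theorem galerkin_apply (p n : ℕ) (x : X n) : galerkin p n x = P n (A p x) := rfl

/-- For `p = 1` the solution of the Galerkin equation is explicit. -/
theorem exists_galerkin_one_eq {n : ℕ} (hn : 1 ≤ n) (z : X n) :
    ∃ x : X n, galerkin 1 n x = z ∧ ‖x‖ ≤ √3 * n * ‖z‖ := by
  have hpi := Real.pi_pos
  obtain ⟨c₀, c, s, hz⟩ := exists_trig_of_mem_X z.2
  -- Chosen so that `z + α • remainder n 2` vanishes at `0`; the solution is then `z'` plus `α`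
  -- times the Dirichlet kernel.
  set α := trig n c₀ c s 0 / (Real.pi / 2) with hα
  have hmem : toL2 (remainderComb n α 0 0 1) + toL2 (trigDeriv n c₀ c s 1) ∈ X n := by
    rw [remainderComb, zero_smul, zero_smul, add_zero, add_zero, map_smul]
    exact add_mem (Submodule.smul_mem _ _ (trigDeriv_mem_X _ _ _ _ _)) (trigDeriv_mem_X _ _ _ _ _)
  refine ⟨⟨_, hmem⟩, ?_, ?_⟩
  · rw [galerkin_apply]
    refine P_eq_of_sub_mem ?_
    have h := A_remainderComb n 0 α 0 0 (trigDeriv n c₀ c s) (hasDerivAt_trigDeriv n c₀ c s) ?_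
    · rw [zero_add] at h
      rw [h, hz]
      convert remainderComb_zero_mem n α 0 0 using 1
      exact add_sub_cancel_left _ _
    · intro j hj
      obtain rfl : j = 0 := by omega
      rw [remainderComb_apply, remainder_two_zero]
      change trig n c₀ c s 0 + _ = 0
      rw [hα]
      field_simp
      ring
  · have hn' : (1 : ℝ) ≤ n := by exact_mod_cast hn
    rw [Submodule.coe_norm, Submodule.coe_norm, hz]
    refine le_of_sq_le_sq ?_ (by positivity)
    set z₀ := trig n c₀ c s 0 with hz₀
    set z₁ := trigDeriv n c₀ c s 1 0 with hz₁
    -- Parity split of the energy: `z(0)` sees only the cosine part `E` and `z'(0)` only the sine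
    -- part `O`. This separation brings the constant down to `√3`.
    set E := 2 * Real.pi * c₀ ^ 2 + Real.pi * ∑ k ∈ Finset.Icc 1 n, c k ^ 2 with hE
    set O := Real.pi * ∑ k ∈ Finset.Icc 1 n, s k ^ 2 with hO
    have hE0 : 0 ≤ E := by positivity
    have hO0 : 0 ≤ O := by positivity
    have hnorm : ‖toL2 (trig n c₀ c s)‖ ^ 2 = E + O := by
      rw [norm_sq_trig, Finset.sum_add_distrib]; ring
    have hb0 : z₀ ^ 2 ≤ (n + 1 / 2) / Real.pi * E := by
      have h := abs_trig_zero_le n c₀ c 0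
      have h2 := pow_le_pow_left₀ (abs_nonneg _) h 2
      rw [sq_abs, mul_pow, Real.sq_sqrt (by positivity), norm_sq_trig] at h2
      have h3 : trig n c₀ c 0 0 = z₀ := by rw [hz₀, trig_zero, trig_zero]
      rw [h3] at h2
      simpa using h2
    have hb1 : z₁ ^ 2 ≤ (n : ℝ) ^ 3 / Real.pi * O := by
      have h : z₁ = ∑ k ∈ Finset.Icc 1 n, (k : ℝ) * s k := by
        rw [hz₁, trigDeriv, trig_zero]
        simp [derivCoeff]
      have h2 : ∑ k ∈ Finset.Icc 1 n, (k : ℝ) ^ 2 ≤ n ^ 3 := by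
        calc _ ≤ ∑ _k ∈ Finset.Icc 1 n, (n : ℝ) ^ 2 := Finset.sum_le_sum fun k hk =>
              pow_le_pow_left₀ (by positivity) (by exact_mod_cast (Finset.mem_Icc.1 hk).2) 2
          _ = _ := by simp; ring
      rw [h]
      refine (Finset.sum_mul_sq_le_sq_mul_sq _ _ _).trans ?_
      rw [hO]
      refine (mul_le_mul_of_nonneg_right h2 (by positivity)).trans_eq ?_
      field_simp
    have hderiv : ‖toL2 (trigDeriv n c₀ c s 1)‖ ^ 2 ≤ (n : ℝ) ^ 2 * (E + O) := by
      rw [← hnorm, ← mul_pow]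
      refine pow_le_pow_left₀ (norm_nonneg _) ?_ 2
      simpa using norm_trigDeriv_le n c₀ c s 1
    have hinner : inner ℝ (toL2 (trigDeriv n c₀ c s 1)) (toL2 (dirichlet n 0)) = Real.pi * z₁ :=
      inner_trig_dirichlet n _ _ _
    have hexp : ‖toL2 (remainderComb n α 0 0 1) + toL2 (trigDeriv n c₀ c s 1)‖ ^ 2
        = 4 / Real.pi * (n + 1 / 2) * z₀ ^ 2 + 4 * (z₀ * z₁)
          + ‖toL2 (trigDeriv n c₀ c s 1)‖ ^ 2 := by
      rw [remainderComb, zero_smul, zero_smul, add_zero, add_zero, map_smul,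
        show remainder n (1 + 2) = dirichlet n 0 from rfl, norm_add_sq_real, norm_smul, mul_pow,
        norm_dirichlet_zero, Real.sq_sqrt (by positivity), inner_smul_left, real_inner_comm,
        hinner, Real.norm_eq_abs, sq_abs, hα]
      simp only [conj_trivial]
      field_simp
      ring
    -- The weight `n` balances `z₀² ≲ n E` against `z₁² ≲ n³ O`, so both terms are of order `n²`.
    have hAM : 4 * (z₀ * z₁) ≤ 2 * (n * z₀ ^ 2 + z₁ ^ 2 / n) := by
      have : 0 ≤ (n * z₀ - z₁) ^ 2 / n := by positivity
      have h2 : (n * z₀ - z₁) ^ 2 / n = n * z₀ ^ 2 + z₁ ^ 2 / n - 2 * (z₀ * z₁) := by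
        field_simp
        ring
      linarith
    have hp1 := Real.pi_gt_d2
    have hinv : 1 / Real.pi ≤ 0.3185 := by
      rw [div_le_iff₀ hpi]; linarith
    have hi0 : 0 < 1 / Real.pi := by positivity
    have hz0' : z₀ ^ 2 ≤ 0.47775 * n * E := by
      calc z₀ ^ 2 ≤ (n + 1 / 2) / Real.pi * E := hb0
        _ = 1 / Real.pi * (n + 1 / 2) * E := by ring
        _ ≤ 0.3185 * (n + 1 / 2 * n) * E := by gcongr; linarith
        _ = _ := by ring
    have hz1' : z₁ ^ 2 / n ≤ 0.3185 * n ^ 2 * O := by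
      rw [div_le_iff₀ (by positivity)]
      calc z₁ ^ 2 ≤ (n : ℝ) ^ 3 / Real.pi * O := hb1
        _ = 1 / Real.pi * n ^ 3 * O := by ring
        _ ≤ 0.3185 * n ^ 3 * O := by gcongr
        _ = _ := by ring
    have hT1 : 4 / Real.pi * (n + 1 / 2) * z₀ ^ 2 ≤ 0.914 * n ^ 2 * E := by
      calc 4 / Real.pi * (n + 1 / 2) * z₀ ^ 2
          = 4 * (1 / Real.pi) * (n + 1 / 2) * z₀ ^ 2 := by ring
        _ ≤ 4 * 0.3185 * (n + 1 / 2 * n) * (0.47775 * n * E) := by gcongr; linarith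
        _ ≤ _ := by nlinarith [mul_nonneg (sq_nonneg (n : ℝ)) hE0]
    have hT2 : n * z₀ ^ 2 ≤ 0.47775 * n ^ 2 * E := by
      calc n * z₀ ^ 2 ≤ n * (0.47775 * n * E) := by gcongr
        _ = _ := by ring
    rw [hexp, mul_pow, mul_pow, hnorm, Real.sq_sqrt (by norm_num)]
    -- The total coefficients of `n² E` and `n² O` are about `2.87` and `1.64`, both below `3`.
    nlinarith [mul_nonneg (sq_nonneg (n : ℝ)) hE0, mul_nonneg (sq_nonneg (n : ℝ)) hO0]

theorem exists_galerkin_eq {p n : ℕ} (hp : p = 1 ∨ p = 2 ∨ p = 3) (hn : 1 ≤ n) (z : X n) :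
    ∃ x : X n, galerkin p n x = z ∧ ‖x‖ ≤ noiseConst p * (n : ℝ) ^ p * ‖z‖ := by
  -- The general argument would give `3/2 + 1` for `p = 1`, which exceeds `√3`.
  by_cases hp1 : p = 1
  · subst hp1
    simpa [noiseConst] using exists_galerkin_one_eq hn z
  obtain ⟨c₀, c, s, hz⟩ := exists_trig_of_mem_X z.2
  have hn' : (1 : ℝ) ≤ n := by exact_mod_cast hn
  obtain ⟨ψ, hψ, h, hh, hA, hb⟩ := exists_approx_solution (n := n) hp (trigDeriv n c₀ c s)
    (hasDerivAt_trigDeriv n c₀ c s) (S := ‖z‖) (fun j _ => by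
      refine (abs_trig_zero_le n _ _ _).trans ?_
      rw [mul_assoc]
      refine mul_le_mul_of_nonneg_left ((norm_trigDeriv_le n c₀ c s j).trans ?_)
        (Real.sqrt_nonneg _)
      rw [← hz]
      refine mul_le_mul_of_nonneg_right ?_ (norm_nonneg _)
      exact pow_le_pow_left₀ (by positivity) (by linarith) j)
  refine ⟨⟨_, add_mem hψ (trigDeriv_mem_X n c₀ c s p)⟩, ?_, ?_⟩
  · rw [galerkin_apply]
    refine P_eq_of_sub_mem ?_
    rw [hA, hz]
    convert hh using 1
    exact add_sub_cancel_left _ _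
  · have hd := norm_trigDeriv_le n c₀ c s p
    rw [← hz] at hd
    have hN : ((n : ℝ) + 1 / 2) ^ p ≤ (3 / 2 * n) ^ p :=
      pow_le_pow_left₀ (by positivity) (by linarith) p
    -- The factor `3/2` comes from `n + 1/2 ≤ 3n/2`, the summand `1` from the `p`-th derivative of
    -- `z`. The values are `9.1` and `98.875`.
    have hM : 0 ≤ stabConst p ∧ stabConst p * (3 / 2) ^ p + 1 ≤ noiseConst p := by
      rcases hp with rfl | rfl | rfl
      · exact absurd rfl hp1
      · norm_num [stabConst, noiseConst]
      · norm_num [stabConst, noiseConst]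
    calc ‖ψ + toL2 (trigDeriv n c₀ c s p)‖
        ≤ stabConst p * ((3 / 2 * n) ^ p * ‖z‖) + (n : ℝ) ^ p * ‖z‖ := by
          refine (norm_add_le _ _).trans (add_le_add (hb.trans ?_) hd)
          have := hM.1
          gcongr
      _ = (stabConst p * (3 / 2) ^ p + 1) * ((n : ℝ) ^ p * ‖z‖) := by rw [mul_pow]; ring
      _ ≤ noiseConst p * ((n : ℝ) ^ p * ‖z‖) := by gcongr; exact hM.2
      _ = _ := by ring

theorem galerkin_injective {p n : ℕ} (hp : p = 1 ∨ p = 2 ∨ p = 3) (hn : 1 ≤ n) :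
    Function.Injective (galerkin p n) :=
  LinearMap.injective_iff_surjective.2 fun z =>
    let ⟨x, hx, _⟩ := exists_galerkin_eq hp hn z
    ⟨x, hx⟩

/-- An exact solution exists, so any least-squares minimiser has residual zero. -/
theorem galerkin_moorePenrose {p n : ℕ} (hp : p = 1 ∨ p = 2 ∨ p = 3) (hn : 1 ≤ n) (z : X n) :
    galerkin p n (moorePenrose (galerkin p n) z) = z := by
  obtain ⟨x, hx, _⟩ := exists_galerkin_eq hp hn z
  have h := (exists_isMinNormLeastSquares (galerkin p n) z).choose_spec.1 x
  rw [hx, sub_self, norm_zero] at h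
  exact sub_eq_zero.1 (norm_le_zero_iff.1 h)

theorem moorePenrose_galerkin {p n : ℕ} (hp : p = 1 ∨ p = 2 ∨ p = 3) (hn : 1 ≤ n) (x : X n) :
    moorePenrose (galerkin p n) (galerkin p n x) = x :=
  galerkin_injective hp hn (galerkin_moorePenrose hp hn _)

/-! ## Parseval's identity -/

theorem memLp_complex (φ : L2) :
    MemLp (fun x => (φ x : ℂ)) 2 (volume.restrict (Ioc 0 (2 * Real.pi))) := by
  rw [restrict_Ioo_eq_restrict_Ioc.symm]
  exact (Lp.memLp φ).ofReal

theorem integral_mul_continuous_integrable (φ : L2) {f : ℝ → ℝ} (hf : Continuous f) :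
    Integrable (fun x => φ x * f x) mu :=
  (Lp.memLp φ).integrable_mul (memLp_of_continuous hf)

theorem norm_sq_fourierCoeffOn (φ : L2) (m : ℤ) :
    ‖fourierCoeffOn Real.two_pi_pos (fun x => (φ x : ℂ)) m‖ ^ 2
      = 1 / (4 * Real.pi ^ 2) * ((∫ x, φ x * Real.cos (m * x) ∂mu) ^ 2
          + (∫ x, φ x * Real.sin (m * x) ∂mu) ^ 2) := by
  have hc := integral_mul_continuous_integrable φ
    (f := fun x => Real.cos (m * x)) (by fun_prop)
  have hs := integral_mul_continuous_integrable φ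
    (f := fun x => Real.sin (m * x)) (by fun_prop)
  have h : ∫ x in (0 : ℝ)..2 * Real.pi,
      fourier (-m) (x : AddCircle (2 * Real.pi - 0)) • (φ x : ℂ)
      = ((∫ x, φ x * Real.cos (m * x) ∂mu : ℝ) : ℂ)
        - ((∫ x, φ x * Real.sin (m * x) ∂mu : ℝ) : ℂ) * Complex.I := by
    rw [intervalIntegral.integral_of_le two_pi_nonneg, integral_Ioc_eq_integral_Ioo,
      ← integral_complex_ofReal, ← integral_complex_ofReal, ← integral_mul_const,
      ← integral_sub hc.ofReal (hs.ofReal.mul_const _)]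
    refine integral_congr_ae (Filter.Eventually.of_forall fun x => ?_)
    simp only [smul_eq_mul]
    rw [fourier_coe_apply, sub_zero]
    have : 2 * (Real.pi : ℂ) * Complex.I * ((-m : ℤ) : ℂ) * x / ((2 * Real.pi : ℝ) : ℂ)
        = ((-(m * x) : ℝ) : ℂ) * Complex.I := by
      have : (Real.pi : ℂ) ≠ 0 := by exact_mod_cast Real.pi_ne_zero
      push_cast
      field_simp
    rw [this, Complex.exp_mul_I, ← Complex.ofReal_cos, ← Complex.ofReal_sin, Real.cos_neg,
      Real.sin_neg]
    push_cast
    ring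
  rw [fourierCoeffOn_eq_integral, h, norm_smul, mul_pow, Complex.sq_norm, Complex.normSq_apply]
  simp [abs_of_pos Real.pi_pos]
  ring

/-- Parseval's identity for the real trigonometric system. -/
theorem hasSum_coeff_sq (φ : L2) :
    HasSum (fun k : ℕ => coeffCos φ (k + 1) ^ 2 + coeffSin φ (k + 1) ^ 2)
      (‖φ‖ ^ 2 - coeffConst φ ^ 2) := by
  have hpi := Real.pi_pos
  have h := (hasSum_sq_fourierCoeffOn Real.two_pi_pos (memLp_complex φ)).nat_add_neg
  simp only [norm_sq_fourierCoeffOn] at h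
  have hn : ∫ x in (0 : ℝ)..2 * Real.pi, ‖(φ x : ℂ)‖ ^ 2 = ‖φ‖ ^ 2 := by
    rw [← integral_mu (fun x => ‖(φ x : ℂ)‖ ^ 2), ← real_inner_self_eq_norm_sq, inner_eq_integral]
    simp [pow_two, Complex.norm_real]
  rw [hn] at h
  -- Pairing `m` with `-m` counts index `0` twice; dropping that term leaves the total minus a
  -- single zeroth square.
  have h2 := ((hasSum_nat_add_iff' 1).2 h).mul_left (2 * Real.pi)
  have e : ∀ a : ℝ, (1 / √Real.pi * a) ^ 2 = 1 / Real.pi * a ^ 2 := fun a => by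
    rw [mul_pow, div_pow, Real.sq_sqrt hpi.le, one_pow]
  convert h2 using 1
  · rfl
  · ext k
    unfold coeffCos coeffSin
    rw [e, e]
    push_cast
    simp only [neg_mul, Real.cos_neg, Real.sin_neg, mul_neg, integral_neg, neg_sq]
    field_simp
    ring
  · unfold coeffConst
    rw [mul_pow, div_pow, Real.sq_sqrt (by positivity)]
    simp
    field_simp
    ring

theorem coeffCos_eq_inner (φ : L2) (k : ℕ) : coeffCos φ k
    = 1 / √Real.pi * inner ℝ φ (toL2 ⟨fun x => Real.cos (k * x), by fun_prop⟩) := by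
  rw [coeffCos, inner_toL2_right]; rfl

theorem coeffSin_eq_inner (φ : L2) (k : ℕ) : coeffSin φ k
    = 1 / √Real.pi * inner ℝ φ (toL2 ⟨fun x => Real.sin (k * x), by fun_prop⟩) := by
  rw [coeffSin, inner_toL2_right]; rfl

theorem coeffConst_eq_inner (φ : L2) :
    coeffConst φ = 1 / √(2 * Real.pi) * inner ℝ φ (toL2 1) := by
  rw [coeffConst, inner_toL2_right]; simp

/-! ### Functions orthogonal to `X_n`: Fourier coefficients and primitives. -/

section Orthogonal

variable {n : ℕ} {r : L2}

theorem inner_eq_zero_of_mem {v : L2} (hr : r ∈ (X n)ᗮ) (hv : v ∈ X n) : inner ℝ r v = 0 :=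
  (Submodule.mem_orthogonal' _ _).1 hr v hv

theorem coeffConst_eq_zero (hr : r ∈ (X n)ᗮ) : coeffConst r = 0 := by
  rw [coeffConst_eq_inner, inner_eq_zero_of_mem hr (toL2_one_mem_X n), mul_zero]

theorem coeffCos_eq_zero (hr : r ∈ (X n)ᗮ) {k : ℕ} (hk : k ∈ Finset.Icc 1 n) :
    coeffCos r k = 0 := by
  rw [coeffCos_eq_inner, inner_eq_zero_of_mem hr (toL2_cos_mem_X hk), mul_zero]

theorem coeffSin_eq_zero (hr : r ∈ (X n)ᗮ) {k : ℕ} (hk : k ∈ Finset.Icc 1 n) :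
    coeffSin r k = 0 := by
  rw [coeffSin_eq_inner, inner_eq_zero_of_mem hr (toL2_sin_mem_X hk), mul_zero]

theorem hasDerivAt_sin_div (k : ℕ) (hk : k ≠ 0) (x : ℝ) :
    HasDerivAt ((1 / (k : ℝ)) • (⟨fun x => Real.sin (k * x), by fun_prop⟩ : C(ℝ, ℝ)) : C(ℝ, ℝ))
      ((⟨fun x => Real.cos (k * x), by fun_prop⟩ : C(ℝ, ℝ)) x) x := by
  have hk' : (k : ℝ) ≠ 0 := by exact_mod_cast hk
  have h0 : HasDerivAt (fun x : ℝ => (k : ℝ) * x) k x := by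
    simpa using (hasDerivAt_id x).const_mul (k : ℝ)
  refine (h0.sin.const_mul (1 / (k : ℝ))).congr_deriv ?_
  simp
  field_simp

theorem hasDerivAt_cos_div (k : ℕ) (hk : k ≠ 0) (x : ℝ) :
    HasDerivAt ((-(1 / (k : ℝ))) • (⟨fun x => Real.cos (k * x), by fun_prop⟩ : C(ℝ, ℝ)) : C(ℝ, ℝ))
      ((⟨fun x => Real.sin (k * x), by fun_prop⟩ : C(ℝ, ℝ)) x) x := by
  have hk' : (k : ℝ) ≠ 0 := by exact_mod_cast hk
  have h0 : HasDerivAt (fun x : ℝ => (k : ℝ) * x) k x := by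
    simpa using (hasDerivAt_id x).const_mul (k : ℝ)
  refine (h0.cos.const_mul (-(1 / (k : ℝ)))).congr_deriv ?_
  simp
  field_simp

theorem inner_toL2_one_cos {k : ℕ} (hk : k ≠ 0) :
    inner ℝ (toL2 1) (toL2 ⟨fun x => Real.cos (k * x), by fun_prop⟩) = 0 := by
  rw [inner_toL2]
  simpa using integral_cos_int_mul (m := k) (by exact_mod_cast hk)

theorem inner_toL2_one_sin (k : ℕ) :
    inner ℝ (toL2 1) (toL2 ⟨fun x => Real.sin (k * x), by fun_prop⟩) = 0 := by
  rw [inner_toL2]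
  simpa using integral_sin_int_mul (m := k)

/-- The mean value of `A⁽¹⁾ r`. -/
noncomputable def primMean (r : L2) : ℝ := inner ℝ (A 1 r) (toL2 1) / (2 * Real.pi)

/-- The primitive of `r` with mean value zero. -/
noncomputable def primZero (r : L2) : L2 := A 1 r - primMean r • toL2 1

theorem inner_toL2_one_self : inner ℝ (toL2 1) (toL2 1) = 2 * Real.pi := by
  rw [inner_toL2]; simp

theorem inner_primZero_one (r : L2) : inner ℝ (primZero r) (toL2 1) = 0 := by
  rw [primZero, inner_sub_left, inner_smul_left, inner_toL2_one_self, primMean, conj_trivial,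
    div_mul_cancel₀ _ Real.two_pi_pos.ne', sub_self]

/-- Testing against the derivative of a trigonometric polynomial moves the derivative onto `r`; the
boundary term vanishes because `r` has mean zero, and the subtracted constant contributes nothing by
periodicity. -/
theorem primZero_mem (hr : r ∈ (X n)ᗮ) : primZero r ∈ (X n)ᗮ := by
  refine mem_X_orthogonal_of_deriv (inner_primZero_one r) fun c s => ?_
  rw [primZero, inner_sub_left, inner_A_one r (hasDerivAt_trig n 0 c s),
    inner_eq_zero_of_mem hr (toL2_one_mem_X n), inner_eq_zero_of_mem hr (trig_mem_X _ _ _ _),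
    inner_smul_left, real_inner_comm, inner_toL2_one_of_deriv (hasDerivAt_trig n 0 c s),
    trig_two_pi]
  simp

theorem coeff_primZero (hr : r ∈ (X n)ᗮ) {k : ℕ} (hk : k ≠ 0) :
    coeffCos (primZero r) k ^ 2 + coeffSin (primZero r) k ^ 2
      = 1 / (k : ℝ) ^ 2 * (coeffCos r k ^ 2 + coeffSin r k ^ 2) := by
  have h1 := inner_eq_zero_of_mem hr (toL2_one_mem_X n)
  simp only [coeffCos_eq_inner, coeffSin_eq_inner, primZero, inner_sub_left, inner_smul_left,
    inner_toL2_one_cos hk, inner_toL2_one_sin, inner_A_one r (hasDerivAt_sin_div k hk),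
    inner_A_one r (hasDerivAt_cos_div k hk), h1, map_smul, inner_smul_right]
  ring

/-- Wirtinger's inequality for functions orthogonal to `X_n`. -/
theorem norm_primZero_le (hr : r ∈ (X n)ᗮ) : ‖primZero r‖ ≤ ‖r‖ / (n + 1 / 2) := by
  refine le_of_sq_le_sq ?_ (by positivity)
  have h1 := hasSum_coeff_sq (primZero r)
  have h2 := (hasSum_coeff_sq r).mul_left (1 / ((n : ℝ) + 1 / 2) ^ 2)
  rw [coeffConst_eq_zero (primZero_mem hr)] at h1
  rw [coeffConst_eq_zero hr] at h2
  have h3 := hasSum_le (fun k => ?_) h1 h2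
  · simp only [ne_eq, OfNat.ofNat_ne_zero, not_false_eq_true, zero_pow, sub_zero] at h3
    refine h3.trans_eq ?_
    rw [div_pow]
    ring
  · rw [coeff_primZero hr (Nat.succ_ne_zero k)]
    by_cases hk : k + 1 ≤ n
    · have hk' : k + 1 ∈ Finset.Icc 1 n := by simp [hk]
      rw [coeffCos_eq_zero hr hk', coeffSin_eq_zero hr hk']
      simp
    · have : (n : ℝ) + 1 ≤ (k + 1 : ℕ) := by exact_mod_cast (by omega : n + 1 ≤ k + 1)
      gcongr
      linarith

/-- Integrating by parts, the mean of the primitive is `-1/(2π)` times the pairing of `r` with `x -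
π`. Modulo `X n` the latter is `2 • remainder n 2`, whose squared norm `π * tailSq n` is at most
`π/N`. -/
theorem abs_primMean_le (hr : r ∈ (X n)ᗮ) :
    |primMean r| ≤ √((n + 1 / 2) / Real.pi) / (n + 1 / 2) * ‖r‖ := by
  have hpi := Real.pi_pos
  have hd : ∀ x, HasDerivAt (⟨fun x => x - Real.pi, by fun_prop⟩ : C(ℝ, ℝ)) ((1 : C(ℝ, ℝ)) x) x :=
    fun x => (hasDerivAt_id x).sub_const _
  have hrem : toL2 (⟨fun x => x - Real.pi, by fun_prop⟩ : C(ℝ, ℝ))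
      = (2 : ℝ) • (toL2 (remainder n 2) - toL2 (trig n 0 0 (fun k => 1 / (k : ℝ)))) := by
    rw [← map_sub, ← map_smul]
    exact toL2_eq_of_eqOn fun x _ => by
      simp only [remainder, ContinuousMap.coe_mk, ContinuousMap.smul_apply,
        ContinuousMap.sub_apply, ContinuousMap.add_apply, smul_eq_mul]
      ring
  have hmean : primMean r = -(1 / Real.pi * inner ℝ r (toL2 (remainder n 2))) := by
    rw [primMean, inner_A_one r hd, inner_eq_zero_of_mem hr (toL2_one_mem_X n), hrem,
      inner_smul_right, inner_sub_right, inner_eq_zero_of_mem hr (trig_mem_X _ _ _ _)]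
    field_simp
    ring
  have hnorm : ‖toL2 (remainder n 2)‖ ≤ Real.pi * (√((n + 1 / 2) / Real.pi) / (n + 1 / 2)) := by
    refine le_of_sq_le_sq ?_ (by positivity)
    rw [norm_sq_remainder_two, mul_pow, div_pow, Real.sq_sqrt (by positivity)]
    refine (mul_le_mul_of_nonneg_left (tailSq_le n) hpi.le).trans_eq ?_
    field_simp
  rw [hmean, abs_neg, abs_mul, abs_of_pos (by positivity)]
  calc 1 / Real.pi * |inner ℝ r (toL2 (remainder n 2))|
      ≤ 1 / Real.pi * (‖r‖ * (Real.pi * (√((n + 1 / 2) / Real.pi) / (n + 1 / 2)))) := by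
        refine mul_le_mul_of_nonneg_left ((abs_real_inner_le_norm _ _).trans ?_) (by positivity)
        gcongr
    _ = _ := by field_simp

/-! ## The action of `A⁽ᵖ⁾` on the orthogonal complement of `X_n` -/

/-- The `j`-th derivative of `x ^ d / d!`. -/
noncomputable def monomialDeriv (d j : ℕ) : C(ℝ, ℝ) :=
  if j ≤ d then ⟨fun x => x ^ (d - j) / ((d - j).factorial : ℝ), by fun_prop⟩ else 0

theorem hasDerivAt_monomialDeriv (d j : ℕ) (x : ℝ) :
    HasDerivAt (monomialDeriv d j) (monomialDeriv d (j + 1) x) x := by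
  rcases lt_trichotomy j d with h | h | h
  · obtain ⟨e, rfl⟩ := Nat.exists_eq_add_of_lt h
    rw [monomialDeriv, monomialDeriv, if_pos (by omega), if_pos (by omega)]
    have e1 : j + e + 1 - j = e + 1 := by omega
    have e2 : j + e + 1 - (j + 1) = e := by omega
    simp only [e1, e2, ContinuousMap.coe_mk]
    refine ((hasDerivAt_pow (e + 1) x).div_const _).congr_deriv ?_
    have : (e.factorial : ℝ) ≠ 0 := by positivity
    rw [Nat.factorial_succ]
    push_cast
    field_simp
  · subst h
    rw [monomialDeriv, monomialDeriv, if_pos le_rfl, if_neg (by omega)]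
    simpa using hasDerivAt_const x (1 : ℝ)
  · rw [monomialDeriv, monomialDeriv, if_neg (by omega), if_neg (by omega)]
    exact hasDerivAt_const x (0 : ℝ)

theorem monomialDeriv_zero (d j : ℕ) : monomialDeriv d j 0 = if j = d then 1 else 0 := by
  rw [monomialDeriv]
  rcases lt_trichotomy j d with h | h | h
  · rw [if_pos h.le, if_neg h.ne]
    simp [Nat.sub_ne_zero_of_lt h]
  · simp [h]
  · rw [if_neg (by omega), if_neg (by omega)]; rfl

theorem monomialDeriv_self (d : ℕ) : monomialDeriv d d = 1 := by
  ext x; simp [monomialDeriv]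

theorem A_one_eq_monomial (d : ℕ) : A (d + 1) (toL2 1) = toL2 (monomialDeriv (d + 1) 0) := by
  rw [← monomialDeriv_self (d + 1)]
  exact A_toL2_chain d _ (hasDerivAt_monomialDeriv (d + 1)) fun j hj => by
    rw [monomialDeriv_zero, if_neg (by omega)]

/-- Modulo the orthogonal complement of `X_n`, `A⁽ᵖ⁾ r` is a polynomial of degree less than `p`,
with small coefficients. -/
theorem exists_polynomial_A_orthogonal (q : ℕ) (hr : r ∈ (X n)ᗮ) :
    ∃ g : ℕ → C(ℝ, ℝ), (∀ j x, HasDerivAt (g j) (g (j + 1) x) x) ∧ (∀ j > q, g j = 0) ∧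
      (∃ h ∈ (X n)ᗮ, A (q + 1) r = toL2 (g 0) + h) ∧
      ∀ j ≤ q, |g j 0| ≤ √((n + 1 / 2) / Real.pi) * ((n : ℝ) + 1 / 2) ^ j
        * (‖r‖ / ((n : ℝ) + 1 / 2) ^ (q + 1)) := by
  have hN : 0 < (n : ℝ) + 1 / 2 := by positivity
  have hdecomp : ∀ r : L2, A 1 r = primMean r • toL2 1 + primZero r := fun r =>
    (add_sub_cancel _ _).symm
  induction q generalizing r with
  | zero =>
    refine ⟨fun j => primMean r • monomialDeriv 0 j,
      fun j x => (hasDerivAt_monomialDeriv 0 j x).const_smul (primMean r), fun j hj => ?_,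
      ⟨primZero r, primZero_mem hr, ?_⟩, fun j hj => ?_⟩
    · simp only [monomialDeriv]
      rw [if_neg (by omega), smul_zero]
    · rw [zero_add, hdecomp, map_smul, monomialDeriv_self]
    · obtain rfl : j = 0 := by omega
      simp only [ContinuousMap.smul_apply, monomialDeriv_zero, if_true, smul_eq_mul, mul_one]
      refine (abs_primMean_le hr).trans_eq ?_
      ring
  | succ q ih =>
    -- The mean of the first primitive contributes the new top monomial `x^(q+1)/(q+1)!`, which
    -- affects only the initial value of order `q + 1`. The lower ones come from `primZero r`, where
    -- Wirtinger's inequality supplies the extra factor `1/N`.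
    obtain ⟨g, hg, hg0, ⟨h, hh, hA⟩, hb⟩ := ih (primZero_mem hr)
    refine ⟨fun j => g j + primMean r • monomialDeriv (q + 1) j,
      fun j x => (hg j x).add ((hasDerivAt_monomialDeriv (q + 1) j x).const_smul (primMean r)),
      fun j hj => ?_, ⟨h, hh, ?_⟩, fun j hj => ?_⟩
    · simp only [monomialDeriv]
      rw [hg0 j (by omega), if_neg (by omega), smul_zero, add_zero]
    · rw [A_succ, hdecomp, map_add, map_smul, hA, A_one_eq_monomial, map_add, map_smul]
      abel
    · simp only [ContinuousMap.add_apply, ContinuousMap.smul_apply, monomialDeriv_zero, smul_eq_mul]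
      rcases Nat.lt_or_ge q j with hj' | hj'
      · obtain rfl : j = q + 1 := by omega
        rw [hg0 _ hj', if_pos rfl, ContinuousMap.zero_apply, zero_add, mul_one]
        refine (abs_primMean_le hr).trans_eq ?_
        rw [pow_succ _ (q + 1)]
        field_simp
      · rw [if_neg (by omega), mul_zero, add_zero]
        refine (hb j hj').trans (mul_le_mul_of_nonneg_left ?_ (by positivity))
        rw [div_le_div_iff₀ (by positivity) (by positivity), pow_succ _ (q + 1)]
        have := (le_div_iff₀ hN).1 (norm_primZero_le hr)
        calc ‖primZero r‖ * (((n : ℝ) + 1 / 2) ^ (q + 1) * ((n : ℝ) + 1 / 2))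
            = ‖primZero r‖ * ((n : ℝ) + 1 / 2) * ((n : ℝ) + 1 / 2) ^ (q + 1) := by ring
          _ ≤ _ := by gcongr

theorem stabConst_le_gammaConst {p : ℕ} (hp : p = 1 ∨ p = 2 ∨ p = 3) :
    stabConst p ≤ gammaConst p := by
  have h3 := Real.pi_gt_three
  rcases hp with rfl | rfl | rfl
  · simp [stabConst, gammaConst]
  · have : (3 : ℝ) ≤ √(decaySq 2) := Real.le_sqrt_of_sq_le (by
      rw [decaySq]
      nlinarith [sq_nonneg √2, sq_nonneg (3 * √2 / 2), sq_nonneg Real.pi])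
    rw [stabConst, gammaConst]
    linarith
  · have : (28 : ℝ) ≤ √(decaySq 3) := Real.le_sqrt_of_sq_le (by
      rw [decaySq]
      nlinarith [sq_nonneg (11 * √2), sq_nonneg (44 * √2 / 3), sq_nonneg (11 * Real.pi)])
    rw [stabConst, gammaConst]
    linarith

/-- The Galerkin solution for the data `A⁽ᵖ⁾ r`, `r ⟂ X_n`, is bounded by `γ⁽ᵖ⁾ ‖r‖`. -/
theorem exists_galerkin_eq_of_orthogonal {p : ℕ} (hp : p = 1 ∨ p = 2 ∨ p = 3) (hr : r ∈ (X n)ᗮ) :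
    ∃ x : X n, galerkin p n x = P n (A p r) ∧ ‖x‖ ≤ gammaConst p * ‖r‖ := by
  have hN : 0 < (n : ℝ) + 1 / 2 := by positivity
  obtain ⟨q, rfl⟩ : ∃ q, p = q + 1 := ⟨p - 1, by omega⟩
  obtain ⟨g, hg, hg0, ⟨h, hh, hA⟩, hb⟩ := exists_polynomial_A_orthogonal q hr
  obtain ⟨ψ, hψ, h', hh', hA', hb'⟩ := exists_approx_solution hp g hg
    (fun j hj => hb j (by omega))
  refine ⟨⟨ψ, hψ⟩, ?_, ?_⟩
  -- The polynomial has degree less than `p`, so its `p`-th derivative vanishes and `ψ` alone is the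
  -- solution.
  · rw [hg0 (q + 1) (by omega), map_zero, add_zero] at hA'
    have hP : ∀ h ∈ (X n)ᗮ, P n h = 0 := fun h hh => P_eq_of_sub_mem (by simpa using hh)
    rw [galerkin_apply, hA, hA', map_add, map_add, hP h hh, hP h' hh']
  · refine hb'.trans ?_
    rw [mul_div_cancel₀ _ (by positivity)]
    exact mul_le_mul_of_nonneg_right (stabConst_le_gammaConst hp) (norm_nonneg _)

/-! ## Decay of the projection error -/

theorem coeff_sub_P (φ : L2) {k : ℕ} (hk : n < k) :
    coeffCos (φ - P n φ) k = coeffCos φ k ∧ coeffSin (φ - P n φ) k = coeffSin φ k := by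
  obtain ⟨c₀, c, s, hz⟩ := exists_trig_of_mem_X (P n φ).2
  have hk' : k ∈ Finset.Icc 1 k := by simp; omega
  -- Padding with zeros up to degree `k > n` makes the coefficient formula at index `k` applicable,
  -- and that coefficient is zero.
  have hext : trig n c₀ c s = trig k c₀ (fun j => if j ≤ n then c j else 0)
      (fun j => if j ≤ n then s j else 0) := by
    ext x
    rw [trig_apply, trig_apply]
    refine congrArg _ ?_
    rw [← Finset.sum_subset (Finset.Icc_subset_Icc_right hk.le)]
    · exact Finset.sum_congr rfl fun j hj => by simp [(Finset.mem_Icc.1 hj).2]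
    · intro j hj hj'
      have : ¬ j ≤ n := fun h => hj' (Finset.mem_Icc.2 ⟨(Finset.mem_Icc.1 hj).1, h⟩)
      simp [this]
  have hc : inner ℝ (toL2 (trig n c₀ c s)) (toL2 ⟨fun x => Real.cos (k * x), by fun_prop⟩) = 0 := by
    rw [hext, real_inner_comm, inner_toL2]
    simp only [ContinuousMap.coe_mk]
    rw [integral_cos_mul_trig hk', if_neg (by omega), mul_zero]
  have hs : inner ℝ (toL2 (trig n c₀ c s)) (toL2 ⟨fun x => Real.sin (k * x), by fun_prop⟩) = 0 := by
    rw [hext, real_inner_comm, inner_toL2]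
    simp only [ContinuousMap.coe_mk]
    rw [integral_sin_mul_trig hk', if_neg (by omega), mul_zero]
  simp only [coeffCos_eq_inner, coeffSin_eq_inner, inner_sub_left, hz, hc, hs, sub_zero, and_self]

/-- Parseval: only frequencies `k > n` survive in the error, with unchanged coefficients, and there
the weight `(1 + k²)^l` is at least `n^(2l)`. -/
theorem norm_sub_P_le (hn : 1 ≤ n) (φ : L2) {l : ℝ} (hl : 0 < l) (hφ : φ ∈ perSobolev l) :
    ‖φ - P n φ‖ ≤ 1 / (n : ℝ) ^ l * perNorm l φ := by
  have hn' : (0 : ℝ) < n := by exact_mod_cast hn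
  have hr : φ - P n φ ∈ (X n)ᗮ := (X n).sub_starProjection_mem_orthogonal φ
  have hs : HasSum (perTerm l φ) (∑' k, perTerm l φ k) := Summable.hasSum hφ
  have h1 := hasSum_coeff_sq (φ - P n φ)
  rw [coeffConst_eq_zero hr] at h1
  have hterm : ∀ k, 0 ≤ perTerm l φ k := fun k => by unfold perTerm; positivity
  have h3 := hasSum_le (fun k => ?_) h1 (hs.mul_left ((1 / (n : ℝ) ^ l) ^ 2))
  · refine le_of_sq_le_sq ?_ (mul_nonneg (by positivity) (Real.sqrt_nonneg _))
    rw [mul_pow, perNorm, Real.sq_sqrt (add_nonneg (sq_nonneg _) (tsum_nonneg hterm))]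
    simp only [ne_eq, OfNat.ofNat_ne_zero, not_false_eq_true, zero_pow, sub_zero] at h3
    exact h3.trans (mul_le_mul_of_nonneg_left (le_add_of_nonneg_left (sq_nonneg _))
      (by positivity))
  · by_cases hk : k + 1 ≤ n
    · have hk' : k + 1 ∈ Finset.Icc 1 n := by simp [hk]
      rw [coeffCos_eq_zero hr hk', coeffSin_eq_zero hr hk']
      have := hterm k
      simp only [ne_eq, OfNat.ofNat_ne_zero, not_false_eq_true, zero_pow, add_zero]
      positivity
    · obtain ⟨e1, e2⟩ := coeff_sub_P (n := n) φ (k := k + 1) (by omega)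
      rw [e1, e2, perTerm, ← mul_assoc]
      refine le_mul_of_one_le_left (by positivity) ?_
      have hkn : (n : ℝ) ≤ (k + 1 : ℕ) := by exact_mod_cast (by omega : n ≤ k + 1)
      have : ((n : ℝ) ^ l) ^ 2 ≤ (1 + ((k + 1 : ℕ) : ℝ) ^ 2) ^ l := by
        rw [← Real.rpow_natCast, ← Real.rpow_mul hn'.le, mul_comm, Real.rpow_mul hn'.le,
          Real.rpow_natCast]
        refine Real.rpow_le_rpow (by positivity) ?_ hl.le
        nlinarith
      rw [div_pow, one_pow, div_mul_eq_mul_div, one_mul, le_div_iff₀ (by positivity), one_mul]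
      exact this

end Orthogonal

/-! ## Weak derivatives -/

/-- Test functions on `(0, 2π)`: of class `C^∞` with compact support inside `(0, 2π)`. -/
structure IsTest (φ : ℝ → ℝ) : Prop where
  contDiff : ContDiff ℝ ∞ φ
  hasCompactSupport : HasCompactSupport φ
  tsupport_subset : tsupport φ ⊆ Ioo 0 (2 * Real.pi)

namespace IsTest

variable {φ ψ : ℝ → ℝ}

theorem deriv (hφ : IsTest φ) : IsTest (deriv φ) :=
  ⟨(contDiff_infty_iff_deriv.1 hφ.contDiff).2, hφ.hasCompactSupport.deriv, tsupport_deriv_subset.trans hφ.tsupport_subset⟩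

theorem eq_zero (hφ : IsTest φ) {x : ℝ} (hx : x ∉ Ioo 0 (2 * Real.pi)) : φ x = 0 :=
  image_eq_zero_of_notMem_tsupport fun h => hx (hφ.tsupport_subset h)

theorem integral_mu (hφ : IsTest φ) : ∫ x, φ x ∂mu = ∫ x, φ x :=
  setIntegral_eq_integral_of_forall_compl_eq_zero fun _ hx => hφ.eq_zero hx

theorem exists_Icc (hφ : IsTest φ) :
    ∃ a b, 0 < a ∧ b < 2 * Real.pi ∧ Function.support φ ⊆ Icc a b := by
  rcases (tsupport φ).eq_empty_or_nonempty with h | h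
  · refine ⟨1, 1, one_pos, by linarith [Real.pi_gt_three], ?_⟩
    rw [tsupport_eq_empty_iff.1 h]
    simp
  · obtain ⟨a, ha⟩ := hφ.hasCompactSupport.isCompact.exists_isLeast h
    obtain ⟨b, hb⟩ := hφ.hasCompactSupport.isCompact.exists_isGreatest h
    exact ⟨a, b, (hφ.tsupport_subset ha.1).1, (hφ.tsupport_subset hb.1).2, fun x hx =>
      ⟨ha.2 (subset_tsupport φ hx), hb.2 (subset_tsupport φ hx)⟩⟩

theorem sub_const_mul (hφ : IsTest φ) (hψ : IsTest ψ) (c : ℝ) :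
    IsTest (fun x => φ x - c * ψ x) := by
  have h2 : HasCompactSupport (fun x => c * ψ x) := hψ.hasCompactSupport.mul_left
  refine ⟨hφ.contDiff.sub (contDiff_const.mul hψ.contDiff), hφ.hasCompactSupport.sub h2, ?_⟩
  refine (tsupport_sub φ (fun x => c * ψ x)).trans (union_subset hφ.tsupport_subset ?_)
  exact (tsupport_mul_subset_right).trans hψ.tsupport_subset

/-- A test function of integral zero is the derivative of a test function. -/
theorem exists_primitive (hφ : IsTest φ) (h0 : ∫ x, φ x = 0) :
    ∃ Φ, IsTest Φ ∧ _root_.deriv Φ = φ := by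
  obtain ⟨a, b, ha, hb, hab⟩ := hφ.exists_Icc
  have hd : ∀ x, HasDerivAt (fun x => ∫ t in (0 : ℝ)..x, φ t) (φ x) x := fun x =>
    intervalIntegral.integral_hasDerivAt_right (hφ.contDiff.continuous.intervalIntegrable _ _)
      (hφ.contDiff.continuous.stronglyMeasurableAtFilter _ _) hφ.contDiff.continuous.continuousAt
  have hderiv : _root_.deriv (fun x => ∫ t in (0 : ℝ)..x, φ t) = φ := funext fun x => (hd x).deriv
  have hsupp : Function.support (fun x => ∫ t in (0 : ℝ)..x, φ t) ⊆ Icc a b := by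
    intro x hx
    by_contra hxab
    refine hx ?_
    rcases lt_or_ge x a with hxa | hxa
    · refine (intervalIntegral.integral_congr (g := fun _ => 0) fun t ht => ?_).trans (by simp)
      refine Function.notMem_support.1 fun h => ?_
      have h1 := (hab h).1
      have h2 := ht.2
      rcases max_choice 0 x with h | h <;> rw [h] at h2 <;> linarith
    · have hxb : b < x := by
        by_contra h
        exact hxab ⟨hxa, not_lt.1 h⟩
      refine (intervalIntegral.integral_eq_integral_of_support_subset fun t ht => ?_).trans h0
      exact ⟨ha.trans_le (hab ht).1, (hab ht).2.trans hxb.le⟩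
  have htsupp := closure_minimal hsupp isClosed_Icc
  refine ⟨_, ⟨contDiff_infty_iff_deriv.2 ⟨fun x => (hd x).differentiableAt, by rw [hderiv]; exact hφ.contDiff⟩,
    HasCompactSupport.of_support_subset_isCompact isCompact_Icc hsupp, htsupp.trans ?_⟩, hderiv⟩
  exact fun x hx => ⟨ha.trans_le hx.1, hx.2.trans_lt hb⟩

theorem exists_integral_eq_one : ∃ φ, IsTest φ ∧ ∫ x, φ x = 1 := by
  have h3 := Real.pi_gt_three
  let f : ContDiffBump Real.pi := ⟨1, 2, one_pos, one_lt_two⟩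
  refine ⟨f.normed volume, ⟨f.contDiff_normed, f.hasCompactSupport_normed, ?_⟩, f.integral_normed⟩
  rw [f.tsupport_normed_eq, Real.closedBall_eq_Icc]
  exact fun x hx => ⟨by have := hx.1; simp only [f] at this; linarith,
    by have := hx.2; simp only [f] at this; linarith⟩

end IsTest

theorem integrable_mul_test (w : L2) {φ : ℝ → ℝ} (hφ : IsTest φ) :
    Integrable (fun x => w x * φ x) mu :=
  integral_mul_continuous_integrable w hφ.contDiff.continuous

/-- The lemma of du Bois-Reymond. -/
theorem eq_const_of_integral_mul_deriv_eq_zero {w : L2}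
    (h : ∀ φ, IsTest φ → ∫ x, w x * deriv φ x ∂mu = 0) : ∃ c : ℝ, w = c • toL2 1 := by
  obtain ⟨η, hη, hη1⟩ := IsTest.exists_integral_eq_one
  set c := ∫ x, w x * η x ∂mu with hc
  refine ⟨c, ?_⟩
  have hint : Integrable (fun x => w x - c) mu := (integrable_L2 w).sub (integrable_const c)
  have hzero := isOpen_Ioo.ae_eq_zero_of_integral_contDiff_smul_eq_zero
    (U := Ioo 0 (2 * Real.pi)) (hint.locallyIntegrable.locallyIntegrableOn _) (μ := mu) ?_
  · rw [← map_smul]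
    refine Lp.ext ?_
    filter_upwards [hzero, toL2_ae (c • 1), ae_restrict_mem measurableSet_Ioo] with x h1 h2 hx
    rw [h2]
    simpa using sub_eq_zero.1 (h1 hx)
  · intro ψ h1 h2 h3
    have hψ : IsTest ψ := ⟨h1, h2, h3⟩
    have hψi : Integrable ψ := h1.continuous.integrable_of_hasCompactSupport h2
    have hηi : Integrable η := hη.contDiff.continuous.integrable_of_hasCompactSupport hη.hasCompactSupport
    -- Subtracting the right multiple of `η` makes the integral zero, so the difference is the
    -- derivative of a test function and the hypothesis applies.
    obtain ⟨Φ, hΦ, hΦ'⟩ := (hψ.sub_const_mul hη (∫ x, ψ x)).exists_primitive (by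
      rw [integral_sub hψi (hηi.const_mul _), integral_const_mul, hη1, mul_one, sub_self])
    have h4 := h Φ hΦ
    rw [hΦ'] at h4
    have e : ∀ x, w x * (ψ x - (∫ x, ψ x) * η x) = w x * ψ x - (∫ x, ψ x) * (w x * η x) :=
      fun x => by ring
    simp only [e] at h4
    rw [integral_sub (integrable_mul_test w hψ) ((integrable_mul_test w hη).const_mul _),
      integral_const_mul, ← hc] at h4
    have e2 : ∀ x, ψ x • (w x - c) = w x * ψ x - ψ x * c := fun x => by
      rw [smul_eq_mul]; ring
    simp only [e2]
    rw [integral_sub (integrable_mul_test w hψ) (hψi.restrict.mul_const c), integral_mul_const,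
      hψ.integral_mu]
    exact h4

/-- Paired with `φ'`, both `z` and `A 1 z'` give `(-1)^k ∫ y φ^(k+1)`, so du Bois-Reymond applies to
their difference. -/
theorem IsWeakDeriv.eq_const_add_A_one {k : ℕ} {y z z' : L2} (hz : IsWeakDeriv k y z)
    (hz' : IsWeakDeriv (k + 1) y z') : ∃ c : ℝ, z = c • toL2 1 + A 1 z' := by
  have h := eq_const_of_integral_mul_deriv_eq_zero (w := z - A 1 z') fun φ hφ => ?_
  · obtain ⟨c, hc⟩ := h
    exact ⟨c, sub_eq_iff_eq_add.1 hc⟩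
  · have h1 := hz _ hφ.deriv.contDiff hφ.deriv.hasCompactSupport hφ.deriv.tsupport_subset
    have h2 := hz' φ hφ.contDiff hφ.hasCompactSupport hφ.tsupport_subset
    have hd : ∀ x, HasDerivAt (⟨φ, hφ.contDiff.continuous⟩ : C(ℝ, ℝ))
        ((⟨deriv φ, hφ.deriv.contDiff.continuous⟩ : C(ℝ, ℝ)) x) x := fun x =>
      ((hφ.contDiff.differentiable (by simp)) x).hasDerivAt
    have h3 := inner_A_one z' hd
    have h4 := inner_toL2_right (z - A 1 z') ⟨deriv φ, hφ.deriv.contDiff.continuous⟩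
    rw [inner_sub_left, h3, inner_toL2_right, inner_toL2_right z' ⟨φ, _⟩] at h4
    simp only [ContinuousMap.coe_mk] at h4
    rw [hφ.eq_zero (x := 2 * Real.pi) (by simp), h1, h2, iteratedDeriv_succ', pow_succ] at h4
    rw [← h4]
    ring

/-! ## The fine representative and the Taylor polynomial -/

theorem prim_toL2 (f : C(ℝ, ℝ)) {x : ℝ} (hx : x ∈ Icc 0 (2 * Real.pi)) :
    prim (toL2 f) x = ∫ t in (0 : ℝ)..x, f t := by
  rw [prim_apply]
  refine intervalIntegral.integral_congr_ae ?_
  filter_upwards [(ae_restrict_iff' measurableSet_Ioo).1 (toL2_ae f),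
    Measure.ae_ne volume (2 * Real.pi)] with t ht htx ht'
  rw [uIoc_of_le hx.1] at ht'
  have h2 : t ∈ Ioo 0 (2 * Real.pi) := ⟨ht'.1, lt_of_le_of_ne (ht'.2.trans hx.2) htx⟩
  rw [indicator_of_mem h2, ht h2]

theorem hasDerivWithinAt_prim_toL2 (f : C(ℝ, ℝ)) {x : ℝ} (hx : x ∈ Icc 0 (2 * Real.pi)) :
    HasDerivWithinAt (prim (toL2 f)) (f x) (Icc 0 (2 * Real.pi)) x := by
  have h : HasDerivAt (fun x => ∫ t in (0 : ℝ)..x, f t) (f x) x :=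
    intervalIntegral.integral_hasDerivAt_right (f.continuous.intervalIntegrable _ _)
      (f.continuous.stronglyMeasurableAtFilter _ _) f.continuous.continuousAt
  exact h.hasDerivWithinAt.congr (fun t ht => prim_toL2 f ht) (prim_toL2 f hx)

theorem iteratedDerivWithin_chain {s : Set ℝ} (hs : UniqueDiffOn ℝ s) {G : ℕ → ℝ → ℝ} {q : ℕ}
    (hG : ∀ j < q, ∀ x ∈ s, HasDerivWithinAt (G j) (G (j + 1) x) s x) {j : ℕ} (hj : j ≤ q) :
    EqOn (iteratedDerivWithin j (G 0) s) (G j) s := by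
  induction j with
  | zero => intro x _; simp
  | succ j ih =>
    intro x hx
    rw [iteratedDerivWithin_succ, derivWithin_congr (ih (by omega)) (ih (by omega) hx)]
    exact (hG j (by omega) x hx).derivWithin (hs x hx)

theorem contDiffOn_chain {s : Set ℝ} (hs : UniqueDiffOn ℝ s) {G : ℕ → ℝ → ℝ} {q : ℕ}
    (hG : ∀ j < q, ∀ x ∈ s, HasDerivWithinAt (G j) (G (j + 1) x) s x)
    (hc : ∀ j ≤ q, ContinuousOn (G j) s) : ContDiffOn ℝ (q : WithTop ℕ∞) (G 0) s := by
  refine contDiffOn_of_continuousOn_differentiableOn_deriv (n := (q : ℕ∞)) (fun m hm => ?_)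
    (fun m hm => ?_)
  · have hm' : m ≤ q := by exact_mod_cast hm
    exact (hc m hm').congr (iteratedDerivWithin_chain hs hG hm')
  · have hm' : m < q := by exact_mod_cast hm
    exact DifferentiableOn.congr (fun x hx => (hG m hm' x hx).differentiableWithinAt)
      (iteratedDerivWithin_chain hs hG hm'.le)

theorem IsFineRep.eqOn {p : ℕ} {y : L2} {f g : ℝ → ℝ} (hf : IsFineRep p y f)
    (hg : IsFineRep p y g) : EqOn f g (Icc 0 (2 * Real.pi)) := by
  refine Measure.eqOn_Icc_of_ae_eq volume Real.two_pi_pos.ne ?_ hf.2.1.continuousOn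
    hg.2.1.continuousOn
  rw [← restrict_Ioo_eq_restrict_Icc]
  exact hf.1.symm.trans hg.1

/-- Fine representatives of the same class agree on all of `[0, 2π]`, so the arbitrary choice in
`fineRep` is harmless. -/
theorem initialValue_eq {p : ℕ} {y : L2} {f : ℝ → ℝ} (hf : IsFineRep p y f) (k : ℕ) :
    initialValue p y k = iteratedDerivWithin k f (Icc 0 (2 * Real.pi)) 0 := by
  have hex : ∃ f, IsFineRep p y f := ⟨f, hf⟩
  have h : IsFineRep p y (fineRep p y) := by
    rw [fineRep, dif_pos hex]
    exact hex.choose_spec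
  exact iteratedDerivWithin_congr (h.eqOn hf) (left_mem_Icc.2 two_pi_nonneg)

theorem eq_sum_add_A {ζ : ℕ → L2} {c : ℕ → ℝ} {q : ℕ}
    (h : ∀ k ≤ q, ζ k = c k • toL2 1 + A 1 (ζ (k + 1))) :
    ζ 0 = ∑ k ∈ Finset.range (q + 1), c k • toL2 (monomialDeriv k 0) + A (q + 1) (ζ (q + 1)) := by
  induction q with
  | zero => simpa [monomialDeriv_self] using h 0 le_rfl
  | succ q ih =>
    rw [Finset.sum_range_succ, ih fun k hk => h k (by omega), h (q + 1) le_rfl, map_add, map_smul,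
      A_one_eq_monomial, ← A_succ, ← add_assoc]

/-- Each weak derivative of order below `p` is a constant plus the primitive of the next. Iterating
gives Taylor's formula with integral remainder; the same primitives form a fine representative,
which identifies the constants with the initial values. -/
theorem sub_taylor_eq {p : ℕ} (hp : 1 ≤ p) {y : L2} (hy : y ∈ sobolev p) :
    y - taylor p y = A p (weakDeriv p y) := by
  obtain ⟨q, rfl⟩ : ∃ q, p = q + 1 := ⟨p - 1, by omega⟩
  let ζ : ℕ → L2 := fun k => if k = 0 then y else weakDeriv k y
  have hζ : ∀ k ≤ q + 1, IsWeakDeriv k y (ζ k) := by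
    intro k hk
    rcases Nat.eq_zero_or_pos k with rfl | hk0
    · intro φ _ _ _
      simp [ζ]
    · have hex := hy k hk0 hk
      simp only [ζ, hk0.ne', if_false, weakDeriv, dif_pos hex]
      exact hex.choose_spec
  choose! c hc using fun k (hk : k ≤ q) => (hζ k (by omega)).eq_const_add_A_one (hζ (k + 1) (by omega))
  let G : ℕ → C(ℝ, ℝ) := fun k => c k • 1 + prim (ζ (k + 1))
  have hGζ : ∀ k ≤ q, ζ k = toL2 (G k) := fun k hk => by
    rw [map_add, map_smul, ← A_one]
    exact hc k hk
  have hG : ∀ j < q, ∀ x ∈ Icc 0 (2 * Real.pi),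
      HasDerivWithinAt (G j) (G (j + 1) x) (Icc 0 (2 * Real.pi)) x := fun j hj x hx => by
    have h := hasDerivWithinAt_prim_toL2 (G (j + 1)) hx
    rw [← hGζ (j + 1) hj] at h
    exact h.const_add (c j • 1)
  have hu : UniqueDiffOn ℝ (Icc 0 (2 * Real.pi)) := uniqueDiffOn_Icc Real.two_pi_pos
  have hchain : ∀ j ≤ q, EqOn (iteratedDerivWithin j (G 0) (Icc 0 (2 * Real.pi))) (G j)
      (Icc 0 (2 * Real.pi)) := fun j hj =>
    iteratedDerivWithin_chain (G := fun j => G j) hu hG hj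
  have hfine : IsFineRep (q + 1) y (G 0) := by
    refine ⟨?_, ?_, c q, ζ (q + 1), fun x hx => ?_⟩
    · have h := hGζ 0 (Nat.zero_le q)
      simp only [ζ, if_true] at h
      rw [h]
      exact toL2_ae _
    · exact contDiffOn_chain (G := fun j => G j) hu hG fun j _ => (G j).continuous.continuousOn
    · rw [Nat.add_sub_cancel, hchain q le_rfl hx]
      simp [G, prim_eq _ hx]
  have hinit : ∀ k ≤ q, initialValue (q + 1) y k = c k := fun k hk => by
    rw [initialValue_eq hfine, hchain k hk (left_mem_Icc.2 two_pi_nonneg)]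
    simp [G, prim_apply]
  have htaylor : taylor (q + 1) y
      = ∑ k ∈ Finset.range (q + 1), c k • toL2 (monomialDeriv k 0) := by
    simp only [← map_smul, ← map_sum]
    refine toL2_eq_of_eqOn (f := ⟨fun x => ∑ k ∈ Finset.range (q + 1),
      initialValue (q + 1) y k / (k.factorial : ℝ) * x ^ k, by fun_prop⟩) fun x _ => ?_
    simp only [ContinuousMap.coe_mk, ContinuousMap.sum_apply]
    refine Finset.sum_congr rfl fun k hk => ?_
    rw [hinit k (by have := Finset.mem_range.1 hk; omega)]
    simp [monomialDeriv]
    ring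
  have h := eq_sum_add_A hc
  simp only [ζ, if_true, Nat.succ_ne_zero, if_false] at h
  rw [htaylor, sub_eq_iff_eq_add']
  exact h

/-! ## The error estimate -/

theorem norm_moorePenrose_sub_le {p n : ℕ} (hp : p = 1 ∨ p = 2 ∨ p = 3) (hn : 1 ≤ n) (e ζ : L2) :
    ‖((moorePenrose (galerkin p n) (P n (e + A p ζ)) : X n) : L2) - ζ‖
      ≤ noiseConst p * (n : ℝ) ^ p * ‖e‖ + (gammaConst p + 1) * ‖ζ - (P n ζ : L2)‖ := by
  have hr : ζ - P n ζ ∈ (X n)ᗮ := (X n).sub_starProjection_mem_orthogonal ζ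
  obtain ⟨x₁, hx₁, hb₁⟩ := exists_galerkin_eq hp hn (P n e)
  obtain ⟨x₂, hx₂, hb₂⟩ := exists_galerkin_eq_of_orthogonal hp hr
  -- The projected data have an exact Galerkin solution with three parts: noise, the component of
  -- `ζ` orthogonal to `X n`, and `P n ζ`, which is reproduced exactly.
  have hsol : P n (e + A p ζ) = galerkin p n (x₁ + x₂ + P n ζ) := by
    rw [map_add (galerkin p n), map_add (galerkin p n), hx₁, hx₂, galerkin_apply, add_assoc,
      ← map_add (P n), ← map_add (A p), sub_add_cancel, ← map_add (P n)]
  have hPe : ‖P n e‖ ≤ ‖e‖ := (X n).norm_orthogonalProjectionOnto_apply_le e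
  have hC : 0 ≤ noiseConst p := by
    rcases hp with rfl | rfl | rfl <;> norm_num [noiseConst]
  rw [hsol, moorePenrose_galerkin hp hn]
  have hsplit : ((x₁ + x₂ + P n ζ : X n) : L2) - ζ = x₁ + x₂ - (ζ - P n ζ) := by
    push_cast
    abel
  rw [hsplit]
  calc ‖(x₁ : L2) + x₂ - (ζ - P n ζ)‖ ≤ ‖(x₁ : L2)‖ + ‖(x₂ : L2)‖ + ‖ζ - (P n ζ : L2)‖ :=
        (norm_sub_le _ _).trans (add_le_add_left (norm_add_le _ _) _)
    _ ≤ noiseConst p * (n : ℝ) ^ p * ‖e‖ + gammaConst p * ‖ζ - (P n ζ : L2)‖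
          + ‖ζ - (P n ζ : L2)‖ := by
        gcongr
        · exact hb₁.trans (mul_le_mul_of_nonneg_left hPe (by positivity))
        · exact hb₂
    _ = _ := by ring

end TrigGalerkin

theorem theorem7p1 (p : ℕ) (hp : p = 1 ∨ p = 2 ∨ p = 3) (n : ℕ) (hn : 1 ≤ n)
    (y yδ : TrigGalerkin.L2) (hy : y ∈ TrigGalerkin.sobolev p)
    (δ : ℝ) (hδ : ‖yδ - y‖ ≤ δ) :
    ‖((TrigGalerkin.moorePenrose (TrigGalerkin.galerkin p n)
          (TrigGalerkin.P n (yδ - TrigGalerkin.taylor p y)) : TrigGalerkin.X n) : TrigGalerkin.L2)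
        - TrigGalerkin.weakDeriv p y‖
      ≤ TrigGalerkin.noiseConst p * (n : ℝ) ^ p * δ
        + (TrigGalerkin.gammaConst p + 1) *
          ‖TrigGalerkin.weakDeriv p y
            - (TrigGalerkin.P n (TrigGalerkin.weakDeriv p y) : TrigGalerkin.L2)‖ ∧
    ∀ l : ℝ, 0 < l → TrigGalerkin.weakDeriv p y ∈ TrigGalerkin.perSobolev l →
      ‖((TrigGalerkin.moorePenrose (TrigGalerkin.galerkin p n)
            (TrigGalerkin.P n (yδ - TrigGalerkin.taylor p y)) : TrigGalerkin.X n) : TrigGalerkin.L2)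
          - TrigGalerkin.weakDeriv p y‖
        ≤ TrigGalerkin.noiseConst p * (n : ℝ) ^ p * δ
          + (TrigGalerkin.gammaConst p + 1) * (1 / (n : ℝ) ^ l) *
            TrigGalerkin.perNorm l (TrigGalerkin.weakDeriv p y) := by
  have hdata : yδ - TrigGalerkin.taylor p y
      = (yδ - y) + TrigGalerkin.A p (TrigGalerkin.weakDeriv p y) := by
    rw [← TrigGalerkin.sub_taylor_eq (by omega) hy, sub_add_sub_cancel]
  have hC : 0 ≤ TrigGalerkin.noiseConst p := by
    rcases hp with rfl | rfl | rfl <;> norm_num [TrigGalerkin.noiseConst]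
  have hmain := (TrigGalerkin.norm_moorePenrose_sub_le hp hn (yδ - y)
    (TrigGalerkin.weakDeriv p y)).trans (add_le_add_left
      (mul_le_mul_of_nonneg_left hδ (mul_nonneg hC (by positivity))) _)
  rw [← hdata] at hmain
  refine ⟨hmain, fun l hl hper => hmain.trans ?_⟩
  have hγ : 0 ≤ TrigGalerkin.gammaConst p + 1 := by
    unfold TrigGalerkin.gammaConst
    positivity
  rw [mul_assoc (TrigGalerkin.gammaConst p + 1)]
  exact add_le_add_right (mul_le_mul_of_nonneg_left
    (TrigGalerkin.norm_sub_P_le hn _ hl hper) hγ) _
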